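/- Let $(Y_i,D_i,Z_i)_{i\ge 1}$ be i.i.d. with law $P$, where $Y_i$ and $D_i$ are real and $Z_i$ takes values in a finite set $\mathcal Z=\{z_1,\dots,z_K\}$ of distinct points with $\mathbb P(Z_i=z_k)>0$ for every $k$. For a function $v$ write $P(v)=\int v\,dP$ and $\widehat P(v)=\frac1n\sum_{i=1}^n v(Y_i,D_i,Z_i)$. Write $1_{B\times C}$ for the function $(y,d,z)\mapsto 1\{y\in B,d\in C\}$ and $1_{z_k}$ for $(y,d,z)\mapsto 1\{z=z_k\}$. For a function $h$ and a pair $g=(g_1,g_2)=(1_{z_k},1_{z_{k'}})$ put $$\phi(h,g)=\frac{P(hg_2)}{P(g_2)}-\frac{P(hg_1)}{P(g_1)},\qquad \widehat\phi(h,g)=\frac{\widehat P(hg_2)}{\widehat P(g_2)}-\frac{\widehat P(hg_1)}{\widehat P(g_1)},\qquad T_n=n\prod_{k=1}^K\widehat P(1_{z_k}),$$ $$\widehat\sigma^2(h,g)=\frac{T_n}{n}\left\{\frac{\widehat P(h^2g_2)}{\widehat P(g_2)^2}-\frac{\widehat P(hg_2)^2}{\widehat P(g_2)^3}+\frac{\widehat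 P(h^2g_1)}{\widehat P(g_1)^2}-\frac{\widehat P(hg_1)^2}{\widehat P(g_1)^3}\right\},$$ where a quotient with zero denominator is read as $0$. Let $\xi_0>0$, and let $\tau_n$ be real numbers with $\tau_n\to\infty$ and $\tau_n/\sqrt n\to0$. Closed intervals may be unbounded or consist of a single point. (a) Binary treatment. Suppose $D_i\in\{0,1\}$. Let $\mathcal G_P=\{(1_{z_k},1_{z_{k'}}):k\ne k'\}$ and $\mathcal H=\{(-1)^d1_{B\times\{d\}}: B\subset\mathbb R \text{ a closed interval}, d\in\{0,1\}\}$, and define $$\mathcal G_0=\Big\{g\in\mathcal G_P:\sup_{h\in\mathcal H}\phi(h,g)=0\Big\},\qquad \widehat{\mathcal G_0}=\Big\{g\in\mathcal G_P:\sqrt{T_n}\,\Big|\sup_{h\in\mathcal H}\frac{\widehat\phi(h,g)}{\max(\xi_0,\widehat\sigma(h,g))}\Big|\le\tau_n\Big\}.$$ Let $\mathscr Z_0$ (respectively $\widehat{\mathscr Z_0}$) be the set of pairs $(z_k,z_{k'})$, $k\neq k'$, with $(1_{z_k},1_{z_{k'}})$ in $\mathcal G_0$ (respectively $\widehat{\mathcal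 G_0}$). Then, as $n\to\infty$, $\mathbb P(\widehat{\mathcal G_0}=\mathcal G_0)\to1$ and $\mathbb P(\widehat{\mathscr Z_0}=\mathscr Z_0)\to1$. (b) Ordered treatment. Suppose $D_i\in\{d_1<\dots<d_J\}$. With $\mathcal G_P$ as in (a), replace $\mathcal H$ by the set of all $1_{B\times\{d_1\}}$ and $-1_{B\times\{d_J\}}$ with $B$ a closed interval, together with all $1_{\mathbb R\times(-\infty,c]}$ with $c\in\mathbb R$, and define $\mathcal G_1,\widehat{\mathcal G_1},\mathscr Z_1,\widehat{\mathscr Z_1}$ by the formulas in (a). Then $\mathbb P(\widehat{\mathcal G_1}=\mathcal G_1)\to1$ and $\mathbb P(\widehat{\mathscr Z_1}=\mathscr Z_1)\to1$. (c) Unordered treatment. Suppose $D_i\in\{d_1,\dots,d_J\}$ with distinct $d_j$. Let $\mathrm G=\{(1_{z_k},1_{z_{k'}}):k<k'\}$, for $v\in\{0,1\}^J$ let $\mathrm H_v=\{(-1)^{v_j}1_{B\times\{d_j\}}: B \text{ a closed interval}, 1\le j\le J\}$, and define $$\mathrm G_1=\Big\{g\in\mathrm G:\min_{v}\sup_{h\in\mathrm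 H_v}\phi(h,g)=0\Big\},\qquad \widehat{\mathrm G_1}=\Big\{g\in\mathrm G:\sqrt{T_n}\,\Big|\min_{v}\sup_{h\in\mathrm H_v}\frac{\widehat\phi(h,g)}{\max(\xi_0,\widehat\sigma(h,g))}\Big|\le\tau_n\Big\},$$ and let $\mathscr Z_1$, $\widehat{\mathscr Z_1}$ be the corresponding sets of pairs $(z_k,z_{k'})$ with $k<k'$. Then $\mathbb P(\widehat{\mathrm G_1}=\mathrm G_1)\to1$ and $\mathbb P(\widehat{\mathscr Z_1}=\mathscr Z_1)\to1$. -/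

import Mathlib

open MeasureTheory ProbabilityTheory Filter Topology Set

namespace PairwiseIV

noncomputable section

/-- The space of observations `(Y, D, Z)`: real outcome, (coded) real treatment, and an instrument
with values in `𝓩`. -/
abbrev Obs (𝓩 : Type*) := ℝ × ℝ × 𝓩

variable {𝓩 : Type*}

/-! ### Indicator functions and function classes -/

/-- The function `1_{B × C × 𝓩}`. -/
def rectInd (B C : Set ℝ) : Obs 𝓩 → ℝ :=
  (B ×ˢ (C ×ˢ (univ : Set 𝓩))).indicator 1

/-- The function `1_{ℝ × ℝ × {ζ}}`. -/
def instInd (ζ : 𝓩) : Obs 𝓩 → ℝ :=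
  ((univ : Set ℝ) ×ˢ ((univ : Set ℝ) ×ˢ ({ζ} : Set 𝓩))).indicator 1

/-- Closed intervals of the real line (bounded or not; one-point intervals are allowed). -/
def IsClosedInterval (B : Set ℝ) : Prop :=
  B.Nonempty ∧ B.OrdConnected ∧ IsClosed B

/-- Binary treatment: all `(-1)^d · 1_{B × {d} × 𝓩}`, `B` a closed interval, `d ∈ {0, 1}`. -/
def binaryTests (𝓩 : Type*) : Set (Obs 𝓩 → ℝ) :=
  {h | ∃ B : Set ℝ, IsClosedInterval B ∧ ∃ d : Fin 2,
    h = (-1 : ℝ) ^ (d : ℕ) • rectInd B {((d : ℕ) : ℝ)}}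

/-- Ordered treatment with smallest level `lo` and largest level `hi`: all `1_{B × {lo} × 𝓩}` and
`-1_{B × {hi} × 𝓩}`, `B` a closed interval, together with all `1_{ℝ × (-∞, c] × 𝓩}`. -/
def orderedTests (𝓩 : Type*) (lo hi : ℝ) : Set (Obs 𝓩 → ℝ) :=
  {h | ∃ B : Set ℝ, IsClosedInterval B ∧ (h = rectInd B {lo} ∨ h = -rectInd B {hi})} ∪
    {h | ∃ c : ℝ, h = rectInd univ (Iic c)}

/-- Unordered treatment with levels `d 0, …, d (J - 1)` and a binary vector `v`: all
`(-1)^(v j) · 1_{B × {d j} × 𝓩}`, `B` a closed interval. -/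
def unorderedTests (𝓩 : Type*) {J : ℕ} (d : Fin J → ℝ) (v : Fin J → Fin 2) : Set (Obs 𝓩 → ℝ) :=
  {h | ∃ B : Set ℝ, IsClosedInterval B ∧ ∃ j : Fin J,
    h = (-1 : ℝ) ^ (v j : ℕ) • rectInd B {d j}}

/-- All pairs `(z_k, z_k')` with `k ≠ k'`. -/
def allPairs {K : ℕ} (z : Fin K → 𝓩) : Set (𝓩 × 𝓩) :=
  {p | ∃ k k' : Fin K, k ≠ k' ∧ p = (z k, z k')}

/-- All pairs `(z_k, z_k')` with `k < k'`. -/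
def increasingPairs {K : ℕ} (z : Fin K → 𝓩) : Set (𝓩 × 𝓩) :=
  {p | ∃ k k' : Fin K, k < k' ∧ p = (z k, z k')}

/-- The pairs of functions `(1_{ℝ × ℝ × {ζ}}, 1_{ℝ × ℝ × {ζ'}})` for the pairs `(ζ, ζ')` in `S`. -/
def indicatorPairs (S : Set (𝓩 × 𝓩)) : Set ((Obs 𝓩 → ℝ) × (Obs 𝓩 → ℝ)) :=
  (fun p : 𝓩 × 𝓩 => (instInd p.1, instInd p.2)) '' S

/-- The pairs of instrument values in `S` whose pair of indicator functions belongs to `G`. -/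
def valuePairs (S : Set (𝓩 × 𝓩)) (G : Set ((Obs 𝓩 → ℝ) × (Obs 𝓩 → ℝ))) : Set (𝓩 × 𝓩) :=
  {p ∈ S | (instInd p.1, instInd p.2) ∈ G}

/-! ### Population and sample functionals -/

/-- `P(v) = ∫ v dP`. -/
def popMean [MeasurableSpace 𝓩] (P : Measure (Obs 𝓩)) (v : Obs 𝓩 → ℝ) : ℝ :=
  ∫ x, v x ∂P

/-- The empirical mean of `v` over the first `n` observations of `x`. -/
def empMean (x : ℕ → Obs 𝓩) (n : ℕ) (v : Obs 𝓩 → ℝ) : ℝ :=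
  (1 / (n : ℝ)) * ∑ i ∈ Finset.range n, v (x i)

/-- `φ(h, g) = E(h g₂) / E(g₂) - E(h g₁) / E(g₁)`, for the functional `E = P` or its empirical
counterpart. -/
def phi (E : (Obs 𝓩 → ℝ) → ℝ) (h : Obs 𝓩 → ℝ) (g : (Obs 𝓩 → ℝ) × (Obs 𝓩 → ℝ)) : ℝ :=
  E (h * g.2) / E g.2 - E (h * g.1) / E g.1

/-- `T_n`: the sample size times the product of the sample frequencies of the instrument values. -/
def effSize {K : ℕ} (z : Fin K → 𝓩) (x : ℕ → Obs 𝓩) (n : ℕ) : ℝ :=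
  n * ∏ k, empMean x n (instInd (z k))

/-- The sample variance `σ̂²(h, g)`; zero denominators give zero, as with `0 · ∞ = 0`. -/
def varHat {K : ℕ} (z : Fin K → 𝓩) (x : ℕ → Obs 𝓩) (n : ℕ) (h : Obs 𝓩 → ℝ)
    (g : (Obs 𝓩 → ℝ) × (Obs 𝓩 → ℝ)) : ℝ :=
  effSize z x n / n *
    (empMean x n (h ^ 2 * g.2) / empMean x n g.2 ^ 2
      - empMean x n (h * g.2) ^ 2 / empMean x n g.2 ^ 3
      + empMean x n (h ^ 2 * g.1) / empMean x n g.1 ^ 2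
      - empMean x n (h * g.1) ^ 2 / empMean x n g.1 ^ 3)

/-- The studentized sample functional `φ̂(h, g) / (ξ₀ ∨ σ̂(h, g))`. -/
def studPhi {K : ℕ} (z : Fin K → 𝓩) (ξ₀ : ℝ) (x : ℕ → Obs 𝓩) (n : ℕ) (h : Obs 𝓩 → ℝ)
    (g : (Obs 𝓩 → ℝ) × (Obs 𝓩 → ℝ)) : ℝ :=
  phi (empMean x n) h g / max ξ₀ (√(varHat z x n h g))

/-! ### Contact sets and their estimators -/

/-- `{g ∈ 𝒢 : sup_{h ∈ H} φ(h, g) = 0}`. -/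
def contactSet [MeasurableSpace 𝓩] (P : Measure (Obs 𝓩)) (H : Set (Obs 𝓩 → ℝ))
    (𝒢 : Set ((Obs 𝓩 → ℝ) × (Obs 𝓩 → ℝ))) : Set ((Obs 𝓩 → ℝ) × (Obs 𝓩 → ℝ)) :=
  {g ∈ 𝒢 | (⨆ h : H, phi (popMean P) h.1 g) = 0}

/-- `{g ∈ 𝒢 : √T_n |sup_{h ∈ H} φ̂(h, g) / (ξ₀ ∨ σ̂(h, g))| ≤ t}`. -/
def contactSetHat {K : ℕ} (z : Fin K → 𝓩) (ξ₀ t : ℝ) (x : ℕ → Obs 𝓩) (n : ℕ)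
    (H : Set (Obs 𝓩 → ℝ)) (𝒢 : Set ((Obs 𝓩 → ℝ) × (Obs 𝓩 → ℝ))) :
    Set ((Obs 𝓩 → ℝ) × (Obs 𝓩 → ℝ)) :=
  {g ∈ 𝒢 | √(effSize z x n) * |⨆ h : H, studPhi z ξ₀ x n h.1 g| ≤ t}

/-- `{g ∈ 𝒢 : min_q sup_{h ∈ H_q} φ(h, g) = 0}` for a finite family of classes `H_q`. -/
def minContactSet [MeasurableSpace 𝓩] {ι : Type*} [Fintype ι] (P : Measure (Obs 𝓩))
    (H : ι → Set (Obs 𝓩 → ℝ)) (𝒢 : Set ((Obs 𝓩 → ℝ) × (Obs 𝓩 → ℝ))) :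
    Set ((Obs 𝓩 → ℝ) × (Obs 𝓩 → ℝ)) :=
  {g ∈ 𝒢 | (⨅ q : ι, ⨆ h : H q, phi (popMean P) h.1 g) = 0}

/-- `{g ∈ 𝒢 : √T_n |min_q sup_{h ∈ H_q} φ̂(h, g) / (ξ₀ ∨ σ̂(h, g))| ≤ t}` for a finite family of
classes `H_q`. -/
def minContactSetHat {ι : Type*} [Fintype ι] {K : ℕ} (z : Fin K → 𝓩) (ξ₀ t : ℝ) (x : ℕ → Obs 𝓩)
    (n : ℕ) (H : ι → Set (Obs 𝓩 → ℝ)) (𝒢 : Set ((Obs 𝓩 → ℝ) × (Obs 𝓩 → ℝ))) :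
    Set ((Obs 𝓩 → ℝ) × (Obs 𝓩 → ℝ)) :=
  {g ∈ 𝒢 | √(effSize z x n) * |⨅ q : ι, ⨆ h : H q, studPhi z ξ₀ x n h.1 g| ≤ t}

end

end PairwiseIV

open PairwiseIV

namespace PairwiseIV

/-! Everything rests on one event: along finitely many increasing chains of half-lines, cut by
instrument value and possibly treatment level, empirical frequencies are within `t` of `P`. An
interval is a difference of two lower sets, so on this event each numerator moves by at most `2t`,
each denominator by at most `t`, and `φ̂` differs from `φ` by at most `12 t / p` uniformly in the
test function, where `p` bounds the instrument probabilities from below. The weights lie in `[ξ₀,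
max ξ₀ √(4/p)]`. Hence (`abs_ciInf_ciSup_div`) the studentized min-sup is `O(t)` when the population
value is zero, and bounded away from zero otherwise once `t` is small.

With `t_n = (ξ₀ p / 12) τ_n / √n` the first case stays below the threshold `τ_n`. In the second case
the statistic grows like `√n`, which dominates `τ_n`. There are finitely many pairs, so
`minContactSetHat_eq` gives exact recovery on the event for all large `n`.

It remains to see that the event has probability tending to one. Since `n t_n²` is a constant
multiple of `τ_n² → ∞`, a tail of order `1 / (n t²)` suffices (`measure_exists_lt_empDev_le`). It
follows from Doob's `L²` inequality for a martingale indexed by the chain itself, the normalized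
count of observations that have not yet entered the growing set. -/

/-! ### Running maxima of real sequences -/

/-- The running maximum `max (0, S 0, …, S n)`. -/
noncomputable def runMax (S : ℕ → ℝ) : ℕ → ℝ
  | 0 => max 0 (S 0)
  | n + 1 => max (runMax S n) (S (n + 1))

lemma runMax_nonneg (S : ℕ → ℝ) (n : ℕ) : 0 ≤ runMax S n := by
  induction n with
  | zero => exact le_max_left _ _
  | succ n ih => exact ih.trans (le_max_left _ _)

lemma le_runMax (S : ℕ → ℝ) {j n : ℕ} (h : j ≤ n) : S j ≤ runMax S n := by
  induction n with
  | zero => obtain rfl : j = 0 := by omega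
            exact le_max_right _ _
  | succ n ih =>
    rcases h.lt_or_eq with h | rfl
    · exact (ih (by omega)).trans (le_max_left _ _)
    · exact le_max_right _ _

lemma runMax_le {S : ℕ → ℝ} {C : ℝ} (hC : 0 ≤ C) (h : ∀ k, S k ≤ C) (n : ℕ) :
    runMax S n ≤ C := by
  induction n with
  | zero => exact max_le hC (h 0)
  | succ n ih => exact max_le ih (h _)

lemma runMax_congr {S S' : ℕ → ℝ} {n : ℕ} (h : ∀ k ≤ n, S k = S' k) :
    runMax S n = runMax S' n := by
  induction n with
  | zero => simp [runMax, h 0 le_rfl]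
  | succ n ih => simp [runMax, h (n + 1) le_rfl, ih fun k hk => h k (by omega)]

lemma measurable_runMax {α : Type*} [MeasurableSpace α] {S : ℕ → α → ℝ}
    (h : ∀ k, Measurable (S k)) (n : ℕ) : Measurable fun a => runMax (fun k => S k a) n := by
  induction n with
  | zero => exact measurable_const.max (h 0)
  | succ n ih => exact ih.max (h _)

/-- Pathwise form of Doob's `L²` maximal inequality. -/
lemma runMax_sq_le (S : ℕ → ℝ) (n : ℕ) :
    runMax S n ^ 2 ≤
      4 * S n ^ 2 - 4 * ∑ k ∈ Finset.range n, runMax S k * (S (k + 1) - S k) := by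
  -- Summation by parts: the maximum changes only when `S` attains it, and each such change costs a
  -- nonnegative square. The claim then follows from `(2 S n - runMax S n)² ≥ 0`.
  have key : ∑ k ∈ Finset.range n, runMax S k * (S (k + 1) - S k) ≤
      runMax S n * S n - runMax S n ^ 2 / 2 := by
    induction n with
    | zero =>
      simp only [Finset.range_zero, Finset.sum_empty, runMax]
      rcases le_total 0 (S 0) with h | h
      · rw [max_eq_right h]; nlinarith
      · rw [max_eq_left h]; simp
    | succ n ih =>
      rw [Finset.sum_range_succ]
      simp only [runMax]
      rcases le_total (runMax S n) (S (n + 1)) with h | h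
      · rw [max_eq_right h]; nlinarith [sq_nonneg (runMax S n - S (n + 1))]
      · rw [max_eq_left h]; nlinarith
  nlinarith [sq_nonneg (2 * S n - runMax S n)]

/-! ### The survival martingale of an increasing chain -/

section Chain

variable {E : Type*} [MeasurableSpace E] (P : Measure E) (A : ℕ → Set E)

/-- The centred survival martingale `1_{x ∉ A k} / P (A k)ᶜ - 1` of an increasing chain. -/
noncomputable def surv (k : ℕ) (x : E) : ℝ :=
  (A k)ᶜ.indicator 1 x / (1 - P.real (A k)) - 1

variable {P A}

lemma measurable_surv (hA : ∀ k, MeasurableSet (A k)) (k : ℕ) : Measurable (surv P A k) :=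
  ((measurable_one.indicator (hA k).compl).div_const _).sub_const _

/-- The restriction to probability at most `1/2` keeps the normalizing factor at most `2`, which
makes the variance bound uniform along the chain. -/
lemma abs_surv_le (hP : ∀ k, P.real (A k) ≤ 1 / 2) (k : ℕ) (x : E) : |surv P A k x| ≤ 1 := by
  have h := hP k
  have h0 : 0 ≤ P.real (A k) := measureReal_nonneg
  have h1 : 1 / (1 - P.real (A k)) ≤ 2 := by
    rw [div_le_iff₀ (by linarith)]; linarith
  have h2 : 0 ≤ 1 / (1 - P.real (A k)) := one_div_nonneg.2 (by linarith)
  unfold surv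
  by_cases hx : x ∈ A k
  · simp [hx]
  · simp only [indicator_of_mem (show x ∈ (A k)ᶜ from hx), Pi.one_apply]
    rw [abs_le]; constructor <;> linarith

lemma integral_surv [IsProbabilityMeasure P] (hA : ∀ k, MeasurableSet (A k))
    (hP : ∀ k, P.real (A k) ≤ 1 / 2) (k : ℕ) : ∫ x, surv P A k x ∂P = 0 := by
  have h := hP k
  unfold surv
  rw [integral_sub, integral_div, integral_indicator_one (hA k).compl, probReal_compl_eq_one_sub (hA k)]
  · rw [div_self (by linarith)]; simp
  · exact ((integrable_const (1 : ℝ)).indicator (hA k).compl).div_const _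
  · exact integrable_const _

variable {Ω : Type*} [MeasurableSpace Ω] {μ : Measure Ω} [IsProbabilityMeasure μ]
  {X : ℕ → Ω → E}

-- The martingale property, obtained without filtrations. If `X i` has already entered `A j`, its
-- increment is zero. If not, it lies outside every earlier set, so its contribution to the path up
-- to `j` is deterministic. Either way the running maximum may be replaced by a function of the
-- other observations, which is independent of the centred increment of `X i`.
omit [IsProbabilityMeasure μ] in
lemma integral_runMax_mul_surv_sub [IsProbabilityMeasure P]
    (hX : ∀ i, Measurable (X i)) (hind : iIndepFun X μ)
    (hlaw : ∀ i, μ.map (X i) = P) (hA : ∀ k, MeasurableSet (A k)) (hmono : Monotone A)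
    (hP : ∀ k, P.real (A k) ≤ 1 / 2) (s : ℝ) (n j i : ℕ) (hi : i ∈ Finset.range n) :
    ∫ ω, runMax (fun k => s * ∑ l ∈ Finset.range n, surv P A k (X l ω)) j *
      (surv P A (j + 1) (X i ω) - surv P A j (X i ω)) ∂μ = 0 := by
  set T := (Finset.range n).erase i with hT
  -- `c k` is the value of `surv P A k` off `A k`; in `G` it stands in for the contribution of
  -- observation `i`.
  let c : ℕ → ℝ := fun k => 1 / (1 - P.real (A k)) - 1
  let G : (T → E) → ℝ := fun y => runMax (fun k => s * (c k + ∑ l : T, surv P A k (y l))) j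
  let U : E → ℝ := fun x => surv P A (j + 1) x - surv P A j x
  have hU : Measurable U := (measurable_surv hA _).sub (measurable_surv hA _)
  have hG : Measurable G := by
    refine measurable_runMax (fun k => ?_) j
    refine Measurable.const_mul (Measurable.const_add ?_ _) _
    exact Finset.measurable_sum _ fun l _ => (measurable_surv hA k).comp (measurable_pi_apply l)
  have hdisj : Disjoint ({i} : Finset ℕ) T := by simp [hT]
  have h1 := hind.indepFun_finset {i} T hdisj hX
  have h2 : IndepFun (fun ω => G fun l : T => X l ω) (fun ω => U (X i ω)) μ := by
    have := h1.symm.comp hG (hU.comp (measurable_pi_apply (⟨i, by simp⟩ : ({i} : Finset ℕ))))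
    exact this
  have h3 : ∀ ω, runMax (fun k => s * ∑ l ∈ Finset.range n, surv P A k (X l ω)) j *
      (surv P A (j + 1) (X i ω) - surv P A j (X i ω)) =
      (fun ω => G fun l : T => X l ω) ω * (fun ω => U (X i ω)) ω := by
    intro ω
    by_cases hx : X i ω ∈ A j
    · have : U (X i ω) = 0 := by
        simp [U, surv, hx, hmono (Nat.le_succ j) hx]
      change _ * U (X i ω) = _ * U (X i ω)
      rw [this]; simp
    · change _ * U (X i ω) = _ * U (X i ω)
      congr 1
      refine runMax_congr fun k hk => ?_
      congr 1
      rw [← Finset.add_sum_erase _ _ hi, Finset.sum_coe_sort T (fun l => surv P A k (X l ω))]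
      congr 1
      have : X i ω ∈ (A k)ᶜ := fun h => hx (hmono hk h)
      simp [surv, c, this]
  simp_rw [h3]
  rw [h2.integral_fun_mul_eq_mul_integral]
  · have : ∫ ω, U (X i ω) ∂μ = ∫ x, U x ∂P := by
      rw [← hlaw i, integral_map (hX i).aemeasurable hU.aestronglyMeasurable]
    rw [this]
    have hint : ∀ k, Integrable (surv P A k) P := fun k =>
      Integrable.of_bound (measurable_surv hA k).aestronglyMeasurable 1
        (ae_of_all _ fun x => abs_surv_le hP k x)
    rw [show U = fun x => surv P A (j + 1) x - surv P A j x from rfl,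
      integral_sub (hint _) (hint _), integral_surv hA hP, integral_surv hA hP]
    simp
  · exact (hG.comp (measurable_pi_lambda _ fun l => hX l)).aestronglyMeasurable
  · exact (hU.comp (hX i)).aestronglyMeasurable

lemma integral_sum_surv_sq_le [IsProbabilityMeasure P]
    (hX : ∀ i, Measurable (X i)) (hind : iIndepFun X μ)
    (hlaw : ∀ i, μ.map (X i) = P) (hA : ∀ k, MeasurableSet (A k))
    (hP : ∀ k, P.real (A k) ≤ 1 / 2) (n j : ℕ) :
    ∫ ω, (∑ l ∈ Finset.range n, surv P A j (X l ω)) ^ 2 ∂μ ≤ n := by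
  have hm : ∀ l, Measurable fun ω => surv P A j (X l ω) := fun l =>
    (measurable_surv hA j).comp (hX l)
  have hL : ∀ l, MemLp (fun ω => surv P A j (X l ω)) 2 μ := fun l =>
    MemLp.of_bound (hm l).aestronglyMeasurable 1 (ae_of_all _ fun ω => abs_surv_le hP j _)
  have hz : ∀ l, ∫ ω, surv P A j (X l ω) ∂μ = 0 := fun l => by
    rw [← integral_surv hA hP j, ← hlaw l, integral_map (hX l).aemeasurable]
    exact (measurable_surv hA j).aestronglyMeasurable
  have hv := IndepFun.variance_sum (s := Finset.range n) (X := fun l ω => surv P A j (X l ω))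
    (fun l _ => hL l) (fun l _ l' _ hne =>
      (hind.indepFun hne).comp (measurable_surv hA j) (measurable_surv hA j))
  rw [variance_of_integral_eq_zero] at hv
  · calc _ = _ := by simpa using hv
      _ ≤ ∑ l ∈ Finset.range n, (1 : ℝ) := by
        refine Finset.sum_le_sum fun l _ => ?_
        rw [variance_of_integral_eq_zero (hm l).aemeasurable (hz l)]
        calc _ ≤ ∫ _, (1 : ℝ) ∂μ := by
              refine integral_mono (hL l).integrable_sq (integrable_const _) fun ω => ?_
              simpa using sq_le_one_iff_abs_le_one _ |>.2 (abs_surv_le hP j (X l ω))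
          _ = 1 := by simp
      _ = n := by simp
  · exact (Finset.aemeasurable_sum _ fun l _ => (hm l).aemeasurable)
  · simp only [Finset.sum_apply]
    rw [integral_finsetSum _ fun l _ => (hL l).integrable (by norm_num)]
    simp [hz]

/-- Integrating the pathwise inequality removes the stochastic sum, leaving four times the terminal
second moment. The sign `s` covers upward and downward deviations at once. -/
lemma integral_runMax_surv_sq_le [IsProbabilityMeasure P]
    (hX : ∀ i, Measurable (X i)) (hind : iIndepFun X μ)
    (hlaw : ∀ i, μ.map (X i) = P) (hA : ∀ k, MeasurableSet (A k)) (hmono : Monotone A)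
    (hP : ∀ k, P.real (A k) ≤ 1 / 2) {s : ℝ} (hs : s ^ 2 = 1) (n m : ℕ) :
    Integrable (fun ω => runMax (fun k => s * ∑ l ∈ Finset.range n, surv P A k (X l ω)) m ^ 2) μ ∧
    ∫ ω, runMax (fun k => s * ∑ l ∈ Finset.range n, surv P A k (X l ω)) m ^ 2 ∂μ ≤ 4 * n := by
  set S : ℕ → Ω → ℝ := fun k ω => s * ∑ l ∈ Finset.range n, surv P A k (X l ω) with hS
  have hs1 : |s| = 1 := by
    rw [← sq_abs] at hs
    exact (pow_eq_one_iff_of_nonneg (abs_nonneg s) two_ne_zero).1 hs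
  have hSm : ∀ k, Measurable (S k) := fun k =>
    (Finset.measurable_sum _ fun l _ => (measurable_surv hA k).comp (hX l)).const_mul _
  have hSb : ∀ k ω, |S k ω| ≤ n := fun k ω => by
    rw [hS, abs_mul, hs1, one_mul]
    refine (Finset.abs_sum_le_sum_abs _ _).trans ?_
    refine (Finset.sum_le_sum fun l _ => abs_surv_le hP k (X l ω)).trans ?_
    simp
  have hRm : ∀ k, Measurable fun ω => runMax (fun k => S k ω) k := measurable_runMax hSm
  have hRb : ∀ k ω, |runMax (fun k => S k ω) k| ≤ n := fun k ω => by
    rw [abs_of_nonneg (runMax_nonneg _ _)]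
    exact runMax_le (by positivity) (fun j => (le_abs_self _).trans (hSb j ω)) _
  have hRi : ∀ k, MemLp (fun ω => runMax (fun k => S k ω) k) 2 μ := fun k =>
    MemLp.of_bound (hRm k).aestronglyMeasurable n (ae_of_all _ fun ω => hRb k ω)
  have hSi : ∀ k, MemLp (S k) 2 μ := fun k =>
    MemLp.of_bound (hSm k).aestronglyMeasurable n (ae_of_all _ fun ω => hSb k ω)
  refine ⟨(hRi m).integrable_sq, ?_⟩
  have hprod : ∀ k, Integrable (fun ω => runMax (fun k => S k ω) k * (S (k + 1) ω - S k ω)) μ :=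
    fun k => (hRi k).integrable_mul ((hSi (k + 1)).sub (hSi k))
  have hzero : ∀ k, ∫ ω, runMax (fun k => S k ω) k * (S (k + 1) ω - S k ω) ∂μ = 0 := fun k => by
    have : ∀ ω, runMax (fun k => S k ω) k * (S (k + 1) ω - S k ω) =
        ∑ i ∈ Finset.range n, s * (runMax (fun k => S k ω) k *
          (surv P A (k + 1) (X i ω) - surv P A k (X i ω))) := fun ω => by
      rw [← Finset.mul_sum, ← Finset.mul_sum, Finset.sum_sub_distrib]
      simp only [hS]; ring
    simp_rw [this]
    rw [integral_finsetSum]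
    · refine Finset.sum_eq_zero fun i hi => ?_
      rw [integral_const_mul, integral_runMax_mul_surv_sub hX hind hlaw hA hmono hP s n k i hi,
        mul_zero]
    · intro i _
      have hN : ∀ k, MemLp (fun ω => surv P A k (X i ω)) 2 μ := fun k =>
        MemLp.of_bound ((measurable_surv hA k).comp (hX i)).aestronglyMeasurable 1
          (ae_of_all _ fun ω => abs_surv_le hP k _)
      exact ((hRi k).integrable_mul ((hN (k + 1)).sub (hN k))).const_mul s
  calc _ ≤ ∫ ω, (4 * S m ω ^ 2 - 4 * ∑ k ∈ Finset.range m,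
          runMax (fun k => S k ω) k * (S (k + 1) ω - S k ω)) ∂μ := by
        refine integral_mono (hRi m).integrable_sq ?_ fun ω => runMax_sq_le (fun k => S k ω) m
        exact ((hSi m).integrable_sq.const_mul 4).sub
          ((integrable_finsetSum _ fun k _ => hprod k).const_mul 4)
    _ = 4 * ∫ ω, S m ω ^ 2 ∂μ := by
        rw [integral_sub ((hSi m).integrable_sq.const_mul 4)
          ((integrable_finsetSum _ fun k _ => hprod k).const_mul 4), integral_const_mul,
          integral_const_mul, integral_finsetSum _ fun k _ => hprod k]
        simp [hzero]
    _ ≤ 4 * n := by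
        have : ∀ ω, S m ω ^ 2 = (∑ l ∈ Finset.range n, surv P A m (X l ω)) ^ 2 := fun ω => by
          simp [hS, mul_pow, hs]
        simp_rw [this]
        have := integral_sum_surv_sq_le hX hind hlaw hA hP n m
        linarith

end Chain

/-! ### Uniform deviations along chains -/

section Deviation

variable {E : Type*} [MeasurableSpace E]

/-- The distance between the empirical frequency of `A` among `x 0, …, x (n - 1)` and `P A`. -/
noncomputable def empDev (P : Measure E) (x : ℕ → E) (n : ℕ) (A : Set E) : ℝ :=
  |1 / (n : ℝ) * ∑ i ∈ Finset.range n, A.indicator 1 (x i) - P.real A|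

variable {P : Measure E}

lemma empDev_compl [IsProbabilityMeasure P] (x : ℕ → E) {n : ℕ} (hn : n ≠ 0) {A : Set E}
    (hA : MeasurableSet A) : empDev P x n Aᶜ = empDev P x n A := by
  have hn' : (n : ℝ) ≠ 0 := by exact_mod_cast hn
  unfold empDev
  rw [probReal_compl_eq_one_sub hA, ← abs_neg]
  congr 1
  have : ∀ y, Aᶜ.indicator (1 : E → ℝ) y = 1 - A.indicator 1 y := fun y => by
    by_cases h : y ∈ A <;> simp [h]
  simp_rw [this]
  rw [Finset.sum_sub_distrib]
  simp only [Finset.sum_const, Finset.card_range, nsmul_eq_mul, mul_one]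
  field_simp
  ring

variable {Ω : Type*} [MeasurableSpace Ω] {μ : Measure Ω} [IsProbabilityMeasure μ]
  {X : ℕ → Ω → E}

/-- The deviation at `A j` is `(1 - P (A j)) / n` times the modulus of the martingale, so a large
deviation forces the running maximum for `s = 1` or `s = -1` above `n t`. Markov's inequality for
its square gives `4 / (n t²)` for each sign. -/
lemma measure_exists_le_lt_empDev_le [IsProbabilityMeasure P]
    (hX : ∀ i, Measurable (X i)) (hind : iIndepFun X μ)
    (hlaw : ∀ i, μ.map (X i) = P) {A : ℕ → Set E} (hA : ∀ k, MeasurableSet (A k))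
    (hmono : Monotone A) (hP : ∀ k, P.real (A k) ≤ 1 / 2) {n : ℕ} (hn : n ≠ 0) {t : ℝ}
    (ht : 0 < t) (m : ℕ) :
    μ {ω | ∃ j ≤ m, t < empDev P (fun i => X i ω) n (A j)} ≤ ENNReal.ofReal (8 / (n * t ^ 2)) := by
  have hn' : (0 : ℝ) < n := by exact_mod_cast Nat.pos_of_ne_zero hn
  let R : ℝ → Ω → ℝ := fun s ω =>
    runMax (fun k => s * ∑ l ∈ Finset.range n, surv P A k (X l ω)) m
  have hR : ∀ s : ℝ, s ^ 2 = 1 → μ.real {ω | (n * t) ^ 2 ≤ R s ω ^ 2} ≤ 4 / (n * t ^ 2) := by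
    intro s hs
    obtain ⟨hi, hle⟩ := integral_runMax_surv_sq_le hX hind hlaw hA hmono hP hs n m
    have := mul_meas_ge_le_integral_of_nonneg
      (ae_of_all μ fun ω => sq_nonneg (R s ω)) hi ((n * t) ^ 2)
    rw [le_div_iff₀ (by positivity)]
    have h4 := this.trans hle
    have : n * (μ.real {ω | (n * t) ^ 2 ≤ R s ω ^ 2} * (n * t ^ 2)) ≤ n * 4 := by
      calc _ = (n * t) ^ 2 * μ.real {ω | (n * t) ^ 2 ≤ R s ω ^ 2} := by ring
        _ ≤ _ := by linarith
    exact le_of_mul_le_mul_left this hn'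
  have hsub : {ω | ∃ j ≤ m, t < empDev P (fun i => X i ω) n (A j)} ⊆
      {ω | (n * t) ^ 2 ≤ R 1 ω ^ 2} ∪ {ω | (n * t) ^ 2 ≤ R (-1) ω ^ 2} := by
    rintro ω ⟨j, hj, hlt⟩
    set S := ∑ l ∈ Finset.range n, surv P A j (X l ω) with hS
    have hp := hP j
    have hp0 : 0 ≤ P.real (A j) := measureReal_nonneg
    have hdev : empDev P (fun i => X i ω) n (A j) = (1 - P.real (A j)) * |S| / n := by
      have hc : ∀ y, (A j)ᶜ.indicator (1 : E → ℝ) y = 1 - (A j).indicator 1 y := fun y => by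
        by_cases h : y ∈ A j <;> simp [h]
      have habs : (1 - P.real (A j)) * |S| / n = |(1 - P.real (A j)) * S / n| := by
        rw [abs_div, abs_mul, abs_of_pos hn',
          abs_of_nonneg (show 0 ≤ 1 - P.real (A j) by linarith)]
      rw [habs, empDev, ← abs_neg]
      congr 1
      rw [hS]
      simp only [surv, hc]
      rw [Finset.sum_sub_distrib, ← Finset.sum_div, Finset.sum_sub_distrib]
      have : 1 - P.real (A j) ≠ 0 := by linarith
      simp only [Finset.sum_const, Finset.card_range, nsmul_eq_mul, mul_one]
      field_simp
      ring
    have hbig : n * t ≤ |S| := by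
      rw [hdev, lt_div_iff₀ hn'] at hlt
      nlinarith [abs_nonneg S]
    have hnt : 0 ≤ n * t := by positivity
    rcases le_abs'.1 hbig with h | h
    · right
      have h1 : (-1) * S ≤ R (-1) ω := le_runMax
        (fun k => (-1) * ∑ l ∈ Finset.range n, surv P A k (X l ω)) hj
      exact pow_le_pow_left₀ hnt (by linarith) 2
    · left
      have h1 : 1 * S ≤ R 1 ω := le_runMax
        (fun k => 1 * ∑ l ∈ Finset.range n, surv P A k (X l ω)) hj
      exact pow_le_pow_left₀ hnt (by linarith) 2
  have := (measureReal_mono (μ := μ) hsub).trans (measureReal_union_le _ _)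
  have h1 := hR 1 (by norm_num)
  have h2 := hR (-1) (by norm_num)
  rw [← ofReal_measureReal (measure_ne_top μ _)]
  refine ENNReal.ofReal_le_ofReal ?_
  calc _ ≤ 4 / (n * t ^ 2) + 4 / (n * t ^ 2) := by linarith
    _ = _ := by ring

lemma exists_monotone_enumeration {α : Type*} [LinearOrder α] (s : Finset α) (hs : s.Nonempty) :
    ∃ u : ℕ → α, Monotone u ∧ (∀ j, u j ∈ s) ∧ ∃ m, ∀ a ∈ s, ∃ j ≤ m, u j = a := by
  induction s using Finset.induction_on_max with
  | empty => simp at hs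
  | insert a s ha ih =>
    rcases s.eq_empty_or_nonempty with rfl | h
    · exact ⟨fun _ => a, monotone_const, by simp, 0, by simp⟩
    · obtain ⟨u, hu, hus, m, hm⟩ := ih h
      refine ⟨fun j => if j ≤ m then u j else a, ?_, ?_, m + 1, ?_⟩
      · intro i j hij
        dsimp only
        split_ifs with h1 h2 h2
        · exact hu hij
        · exact (ha _ (hus i)).le
        · omega
        · exact le_rfl
      · intro j
        dsimp only
        split_ifs
        · exact Finset.mem_insert_of_mem (hus j)
        · exact Finset.mem_insert_self _ _
      · intro b hb
        rcases Finset.mem_insert.1 hb with rfl | hb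
        · exact ⟨m + 1, le_rfl, by simp⟩
        · obtain ⟨j, hj, rfl⟩ := hm b hb
          exact ⟨j, by omega, by simp [hj]⟩

lemma measure_exists_mem_lt_empDev_le_of_le_half [IsProbabilityMeasure P]
    (hX : ∀ i, Measurable (X i)) (hind : iIndepFun X μ)
    (hlaw : ∀ i, μ.map (X i) = P) {α : Type*} [LinearOrder α] {A : α → Set E}
    (hA : ∀ a, MeasurableSet (A a)) (hmono : Monotone A) (s : Finset α)
    (hP : ∀ a ∈ s, P.real (A a) ≤ 1 / 2) {n : ℕ} (hn : n ≠ 0) {t : ℝ} (ht : 0 < t) :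
    μ {ω | ∃ a ∈ s, t < empDev P (fun i => X i ω) n (A a)} ≤
      ENNReal.ofReal (8 / (n * t ^ 2)) := by
  rcases s.eq_empty_or_nonempty with rfl | hs
  · simp
  obtain ⟨u, hu, hus, m, hm⟩ := exists_monotone_enumeration s hs
  refine (measure_mono ?_).trans (measure_exists_le_lt_empDev_le hX hind hlaw
    (A := fun j => A (u j)) (fun _ => hA _) (hmono.comp hu) (fun k => hP _ (hus k)) hn ht m)
  rintro ω ⟨a, ha, h⟩
  obtain ⟨j, hj, rfl⟩ := hm a ha
  exact ⟨j, hj, h⟩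

lemma measure_exists_mem_lt_empDev_le [IsProbabilityMeasure P]
    (hX : ∀ i, Measurable (X i)) (hind : iIndepFun X μ)
    (hlaw : ∀ i, μ.map (X i) = P) {α : Type*} [LinearOrder α] {A : α → Set E}
    (hA : ∀ a, MeasurableSet (A a)) (hmono : Monotone A) (s : Finset α)
    {n : ℕ} (hn : n ≠ 0) {t : ℝ} (ht : 0 < t) :
    μ {ω | ∃ a ∈ s, t < empDev P (fun i => X i ω) n (A a)} ≤
      ENNReal.ofReal (16 / (n * t ^ 2)) := by
  classical
  have h1 := measure_exists_mem_lt_empDev_le_of_le_half hX hind hlaw hA hmono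
    (s.filter fun a => P.real (A a) ≤ 1 / 2) (fun a ha => (Finset.mem_filter.1 ha).2) hn ht
  have h2 := measure_exists_mem_lt_empDev_le_of_le_half hX hind hlaw
    -- Sets of probability above `1/2` are replaced by their complements, which have the same
    -- deviation and increase for the dual order.
    (A := fun a : αᵒᵈ => (A (OrderDual.ofDual a))ᶜ)
    (fun a => (hA _).compl) (fun a b hab => compl_subset_compl.2 (hmono hab))
    ((s.filter fun a => ¬ P.real (A a) ≤ 1 / 2).map OrderDual.toDual.toEmbedding)
    (fun a ha => by
      simp only [Finset.mem_map_equiv, Finset.mem_filter] at ha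
      rw [probReal_compl_eq_one_sub (hA _)]
      have := ha.2
      simp only [OrderDual.toDual_symm_eq] at this
      linarith) hn ht
  refine (measure_mono (t := {ω | ∃ a ∈ s.filter fun a => P.real (A a) ≤ 1 / 2,
      t < empDev P (fun i => X i ω) n (A a)} ∪ {ω | ∃ a ∈ (s.filter fun a =>
        ¬ P.real (A a) ≤ 1 / 2).map OrderDual.toDual.toEmbedding,
        t < empDev P (fun i => X i ω) n (A (OrderDual.ofDual a))ᶜ}) ?_).trans
      ((measure_union_le _ _).trans ((add_le_add h1 h2).trans ?_))
  · rintro ω ⟨a, ha, h⟩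
    by_cases hp : P.real (A a) ≤ 1 / 2
    · exact Or.inl ⟨a, Finset.mem_filter.2 ⟨ha, hp⟩, h⟩
    · refine Or.inr ⟨OrderDual.toDual a, ?_, ?_⟩
      · simpa using ⟨ha, lt_of_not_ge (by simpa using hp)⟩
      · rw [empDev_compl _ hn (hA _)]; exact h
  · rw [← ENNReal.ofReal_add (by positivity) (by positivity)]
    refine ENNReal.ofReal_le_ofReal (le_of_eq ?_)
    ring

/-- A Dvoretzky–Kiefer–Wolfowitz type inequality, with a Chebyshev tail, for countable chains. -/
theorem measure_exists_lt_empDev_le [IsProbabilityMeasure P]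
    (hX : ∀ i, Measurable (X i)) (hind : iIndepFun X μ)
    (hlaw : ∀ i, μ.map (X i) = P) {α : Type*} [LinearOrder α] [Countable α] {A : α → Set E}
    (hA : ∀ a, MeasurableSet (A a)) (hmono : Monotone A)
    {n : ℕ} (hn : n ≠ 0) {t : ℝ} (ht : 0 < t) :
    μ {ω | ∃ a, t < empDev P (fun i => X i ω) n (A a)} ≤
      ENNReal.ofReal (16 / (n * t ^ 2)) := by
  have : {ω | ∃ a, t < empDev P (fun i => X i ω) n (A a)} =
      ⋃ s : Finset α, {ω | ∃ a ∈ s, t < empDev P (fun i => X i ω) n (A a)} := by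
    ext ω
    simp only [mem_ofPred_eq, mem_iUnion]
    exact ⟨fun ⟨a, h⟩ => ⟨{a}, a, by simp, h⟩, fun ⟨_, a, _, h⟩ => ⟨a, h⟩⟩
  -- The bound does not depend on the finite subfamily, so it passes to the directed union.
  rw [this, Directed.measure_iUnion]
  · exact iSup_le fun s => measure_exists_mem_lt_empDev_le hX hind hlaw hA hmono s hn ht
  · classical
    intro s s'
    refine ⟨s ∪ s', ?_, ?_⟩
    · rintro ω ⟨a, ha, h⟩
      exact ⟨a, Finset.mem_union_left _ ha, h⟩
    · rintro ω ⟨a, ha, h⟩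
      exact ⟨a, Finset.mem_union_right _ ha, h⟩

/-- The same bound, uniformly over finitely many chains and for almost everywhere measurable
observations. -/
theorem measure_exists_exists_lt_empDev_le (hind : iIndepFun X μ)
    (hlaw : ∀ i, HasLaw (X i) P μ) {ι α : Type*} [Fintype ι] [LinearOrder α] [Countable α]
    {A : ι → α → Set E} (hA : ∀ c a, MeasurableSet (A c a)) (hmono : ∀ c, Monotone (A c))
    {n : ℕ} (hn : n ≠ 0) {t : ℝ} (ht : 0 < t) :
    μ {ω | ∃ c a, t < empDev P (fun i => X i ω) n (A c a)} ≤
      Fintype.card ι * ENNReal.ofReal (16 / (n * t ^ 2)) := by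
  have hP : IsProbabilityMeasure P := (hlaw 0).isProbabilityMeasure_iff.1 ‹_›
  let X' : ℕ → Ω → E := fun i => (hlaw i).aemeasurable.mk
  have hae : ∀ i, X i =ᵐ[μ] X' i := fun i => (hlaw i).aemeasurable.ae_eq_mk
  have hX' : ∀ i, Measurable (X' i) := fun i => (hlaw i).aemeasurable.measurable_mk
  have hind' : iIndepFun X' μ := hind.congr hae
  have hlaw' : ∀ i, μ.map (X' i) = P := fun i => by
    rw [← Measure.map_congr (hae i)]; exact (hlaw i).map_eq
  have : {ω | ∃ c a, t < empDev P (fun i => X i ω) n (A c a)} ≤ᵐ[μ]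
      (⋃ c, {ω | ∃ a, t < empDev P (fun i => X' i ω) n (A c a)} : Set Ω) := by
    filter_upwards [ae_all_iff.2 hae] with ω hω
    rintro ⟨c, a, h⟩
    simp only [hω] at h
    exact mem_iUnion.2 ⟨c, a, h⟩
  refine (measure_mono_ae this).trans ((measure_iUnion_fintype_le _ _).trans ?_)
  refine (Finset.sum_le_sum fun c _ => measure_exists_lt_empDev_le hX' hind' hlaw' (hA c)
    (hmono c) hn ht).trans ?_
  simp

end Deviation

/-! ### From rational half-lines to all intervals -/

section Intervals

variable {E : Type*} [MeasurableSpace E] {P : Measure E}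

lemma tendsto_empDev [IsFiniteMeasure P] (x : ℕ → E) (n : ℕ) {A : ℕ → Set E} {B : Set E}
    (hA : ∀ m, MeasurableSet (A m)) (h : ∀ y, ∀ᶠ m in atTop, y ∈ A m ↔ y ∈ B) :
    Tendsto (fun m => empDev P x n (A m)) atTop (𝓝 (empDev P x n B)) := by
  refine Tendsto.abs (Tendsto.sub (Tendsto.const_mul _ (tendsto_finsetSum _ fun i _ => ?_)) ?_)
  · refine tendsto_const_nhds.congr' ?_
    filter_upwards [h (x i)] with m hm
    by_cases hx : x i ∈ B
    · simp [hx, hm.2 hx]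
    · simp [hx, mt hm.1 hx]
  · exact (ENNReal.tendsto_toReal (measure_ne_top _ _)).comp
      (tendsto_measure_of_tendsto_indicator_of_isFiniteMeasure atTop P hA h)

lemma empDev_diff_le [IsFiniteMeasure P] (x : ℕ → E) (n : ℕ) {A B : Set E}
    (hB : MeasurableSet B) (h : B ⊆ A) :
    empDev P x n (A \ B) ≤ empDev P x n A + empDev P x n B := by
  have : ∀ y, (A \ B).indicator (1 : E → ℝ) y = A.indicator 1 y - B.indicator 1 y := fun y => by
    by_cases hA : y ∈ A
    · by_cases hB : y ∈ B <;> simp [hA, hB]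
    · simp [hA, mt (@h y) hA]
  unfold empDev
  simp_rw [this]
  rw [measureReal_sdiff h hB, Finset.sum_sub_distrib, mul_sub, sub_sub_sub_comm]
  exact abs_sub _ _

variable {W : E → ℝ} {S : Set E} {x : ℕ → E} {n : ℕ} {t : ℝ}

lemma empDev_Iic_le [IsFiniteMeasure P] (hW : Measurable W) (hS : MeasurableSet S)
    (h : ∀ q : ℚ, empDev P x n (W ⁻¹' Iic (q : ℝ) ∩ S) ≤ t) (a : ℝ) :
    empDev P x n (W ⁻¹' Iic a ∩ S) ≤ t := by
  obtain ⟨u, -, hua, hu⟩ := exists_seq_strictAnti_tendsto a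
  -- Rationals decreasing strictly to `a` recover the closed half-line; the open one needs
  -- approximation from below.
  choose q hq using fun m => exists_rat_btwn (hua m)
  refine le_of_tendsto' (tendsto_empDev x n (A := fun m => W ⁻¹' Iic (q m : ℝ) ∩ S)
    (fun m => (hW measurableSet_Iic).inter hS) fun y => ?_) fun m => h (q m)
  by_cases hy : W y ≤ a
  · exact .of_forall fun m => by simp [hy, hy.trans (hq m).1.le]
  · filter_upwards [hu.eventually (gt_mem_nhds (not_le.1 hy))] with m hm
    have : ¬ W y ≤ q m := not_le.2 ((hq m).2.trans hm)
    simp [hy, this]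

lemma empDev_Iio_le [IsFiniteMeasure P] (hW : Measurable W) (hS : MeasurableSet S)
    (h : ∀ q : ℚ, empDev P x n (W ⁻¹' Iic (q : ℝ) ∩ S) ≤ t) (a : ℝ) :
    empDev P x n (W ⁻¹' Iio a ∩ S) ≤ t := by
  obtain ⟨u, -, hua, hu⟩ := exists_seq_strictMono_tendsto a
  choose q hq using fun m => exists_rat_btwn (hua m)
  refine le_of_tendsto' (tendsto_empDev x n (A := fun m => W ⁻¹' Iic (q m : ℝ) ∩ S)
    (fun m => (hW measurableSet_Iic).inter hS) fun y => ?_) fun m => h (q m)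
  by_cases hy : W y < a
  · filter_upwards [hu.eventually (lt_mem_nhds hy)] with m hm
    simp [hy, (hm.trans (hq m).1).le]
  · refine .of_forall fun m => ?_
    have : ¬ W y ≤ q m := not_le.2 ((hq m).2.trans_le (not_lt.1 hy))
    simp [hy, this]

lemma empDev_univ_le [IsFiniteMeasure P] (hW : Measurable W) (hS : MeasurableSet S)
    (h : ∀ q : ℚ, empDev P x n (W ⁻¹' Iic (q : ℝ) ∩ S) ≤ t) :
    empDev P x n S ≤ t := by
  refine le_of_tendsto' (tendsto_empDev x n (A := fun m : ℕ => W ⁻¹' Iic (m : ℝ) ∩ S)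
    (fun m => (hW measurableSet_Iic).inter hS) fun y => ?_) fun m => by simpa using h m
  filter_upwards [tendsto_natCast_atTop_atTop.eventually (eventually_ge_atTop (W y))] with m hm
  simp [hm]

/-- A lower set of reals is empty, a closed or open half-line, or everything, and each is a limit of
rational half-lines. -/
lemma empDev_isLowerSet_le [IsFiniteMeasure P] (hW : Measurable W) (hS : MeasurableSet S)
    (h : ∀ q : ℚ, empDev P x n (W ⁻¹' Iic (q : ℝ) ∩ S) ≤ t) {I : Set ℝ} (hI : IsLowerSet I) :
    empDev P x n (W ⁻¹' I ∩ S) ≤ t := by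
  rcases I.eq_empty_or_nonempty with rfl | hne
  · have : (0 : ℝ) ≤ t := (abs_nonneg _).trans (h 0)
    simpa [empDev] using this
  by_cases hb : BddAbove I
  · by_cases hm : sSup I ∈ I
    · have : I = Iic (sSup I) :=
        Subset.antisymm (fun y hy => le_csSup hb hy) fun y hy => hI hy hm
      rw [this]; exact empDev_Iic_le hW hS h _
    · have : I = Iio (sSup I) := by
        refine Subset.antisymm (fun y hy => (le_csSup hb hy).lt_of_ne ?_) fun y hy => ?_
        · rintro rfl; exact hm hy
        · obtain ⟨b, hb, hyb⟩ := exists_lt_of_lt_csSup hne hy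
          exact hI hyb.le hb
      rw [this]; exact empDev_Iio_le hW hS h _
  · have : I = univ := by
      refine eq_univ_of_forall fun y => ?_
      obtain ⟨b, hb, hyb⟩ := not_bddAbove_iff.1 hb y
      exact hI hyb.le hb
    rw [this]; simpa using empDev_univ_le hW hS h

lemma empDev_ordConnected_le [IsFiniteMeasure P] (hW : Measurable W) (hS : MeasurableSet S)
    (h : ∀ q : ℚ, empDev P x n (W ⁻¹' Iic (q : ℝ) ∩ S) ≤ t) {B : Set ℝ} (hB : B.OrdConnected)
    (hne : B.Nonempty) : empDev P x n (W ⁻¹' B ∩ S) ≤ 2 * t := by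
  -- `U` is the lower closure of `B` and `V` the points strictly below all of `B`;
  -- order-connectedness gives `B = U \ V`. The factor `2` counts these two lower sets.
  let U : Set ℝ := {y | ∃ b ∈ B, y ≤ b}
  let V : Set ℝ := {y | ∀ b ∈ B, y < b}
  have hU : IsLowerSet U := fun y y' hy ⟨b, hb, hyb⟩ => ⟨b, hb, hy.trans hyb⟩
  have hV : IsLowerSet V := fun y y' hy h b hb => hy.trans_lt (h b hb)
  have hVU : V ⊆ U := fun y hy => hne.imp fun b hb => ⟨hb, (hy b hb).le⟩
  have hBUV : W ⁻¹' B ∩ S = (W ⁻¹' U ∩ S) \ (W ⁻¹' V ∩ S) := by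
    ext y
    constructor
    · rintro ⟨hy, hyS⟩
      exact ⟨⟨⟨_, hy, le_rfl⟩, hyS⟩, fun hyV => lt_irrefl _ (hyV.1 _ hy)⟩
    · rintro ⟨⟨⟨b, hb, hyb⟩, hyS⟩, hyV⟩
      refine ⟨?_, hyS⟩
      have : ¬ ∀ b ∈ B, W y < b := fun h => hyV ⟨h, hyS⟩
      push Not at this
      obtain ⟨b', hb', hb'y⟩ := this
      exact hB.out hb' hb ⟨hb'y, hyb⟩
  rw [hBUV]
  have hVm : MeasurableSet V := hV.ordConnected.measurableSet
  refine (empDev_diff_le x n ((hW hVm).inter hS)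
    (inter_subset_inter_left _ (preimage_mono hVU))).trans ?_
  have h1 := empDev_isLowerSet_le hW hS h hU
  have h2 := empDev_isLowerSet_le hW hS h hV
  linarith

end Intervals

/-! ### Perturbation of weighted min-sups -/

section Order

/-- Monotone continuous maps commute with bounded suprema and infima, so pointwise envelopes of `g`
in terms of `f` survive the min-sup. -/
lemma ciInf_ciSup_mem_Icc {ι : Type*} [Finite ι] [Nonempty ι] {H : ι → Type*}
    [∀ q, Nonempty (H q)] {f g : (q : ι) → H q → ℝ} {C : ℝ} (hf : ∀ q h, |f q h| ≤ C)
    {L U : ℝ → ℝ} (hL : Monotone L) (hU : Monotone U) (hLc : Continuous L) (hUc : Continuous U)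
    (hLg : ∀ q h, L (f q h) ≤ g q h) (hgU : ∀ q h, g q h ≤ U (f q h)) :
    (⨅ q, ⨆ h, g q h) ∈ Icc (L (⨅ q, ⨆ h, f q h)) (U (⨅ q, ⨆ h, f q h)) := by
  have hbf : ∀ q, BddAbove (range (f q)) := fun q =>
    ⟨C, by rintro _ ⟨h, rfl⟩; exact (le_abs_self _).trans (hf q h)⟩
  have hbU : ∀ q, BddAbove (range fun h => U (f q h)) := fun q =>
    ⟨U C, by rintro _ ⟨h, rfl⟩; exact hU ((le_abs_self _).trans (hf q h))⟩
  have hbg : ∀ q, BddAbove (range (g q)) := fun q =>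
    ⟨U C, by rintro _ ⟨h, rfl⟩; exact (hgU q h).trans (hU ((le_abs_self _).trans (hf q h)))⟩
  have hfin : ∀ F : ι → ℝ, BddBelow (range F) := fun F => (finite_range F).bddBelow
  constructor
  · rw [hL.map_ciInf_of_continuousAt hLc.continuousAt (hfin _)]
    refine ciInf_mono (hfin _) fun q => ?_
    rw [hL.map_ciSup_of_continuousAt hLc.continuousAt (hbf q)]
    exact ciSup_mono (hbg q) (hLg q)
  · rw [hU.map_ciInf_of_continuousAt hUc.continuousAt (hfin _)]
    refine ciInf_mono (hfin _) fun q => ?_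
    rw [hU.map_ciSup_of_continuousAt hUc.continuousAt (hbf q)]
    exact ciSup_mono (hbU q) (hgU q)

/-- If `φ'` is uniformly `δ`-close to `φ` and the weights lie in `[a, b]`, then the weighted
min-sup of `φ'` is small when the min-sup of `φ` vanishes and bounded away from zero otherwise. -/
lemma abs_ciInf_ciSup_div {ι : Type*} [Finite ι] [Nonempty ι] {H : ι → Type*}
    [∀ q, Nonempty (H q)] {φ φ' w : (q : ι) → H q → ℝ} {C δ a b : ℝ}
    (hC : ∀ q h, |φ q h| ≤ C) (hδ : ∀ q h, |φ' q h - φ q h| ≤ δ) (ha : 0 < a) (hab : a ≤ b)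
    (hwa : ∀ q h, a ≤ w q h) (hwb : ∀ q h, w q h ≤ b) :
    ((⨅ q, ⨆ h, φ q h) = 0 → |⨅ q, ⨆ h, φ' q h / w q h| ≤ δ / a) ∧
    ((⨅ q, ⨆ h, φ q h) ≠ 0 → δ ≤ |⨅ q, ⨆ h, φ q h| / 2 →
      |⨅ q, ⨆ h, φ q h| / (2 * b) ≤ |⨅ q, ⨆ h, φ' q h / w q h|) := by
  have hb : 0 < b := ha.trans_le hab
  -- For fixed `s`, the extremes of `s / v` over `v ∈ [a, b]` occur at an endpoint, and which one
  -- depends on the sign of `s`; hence the `min` and `max`.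
  let L : ℝ → ℝ := fun s => min ((s - δ) / a) ((s - δ) / b)
  let U : ℝ → ℝ := fun s => max ((s + δ) / a) ((s + δ) / b)
  have hL : Monotone L := fun s s' h => min_le_min (by gcongr) (by gcongr)
  have hU : Monotone U := fun s s' h => max_le_max (by gcongr) (by gcongr)
  have hdiv : ∀ s v : ℝ, a ≤ v → v ≤ b → s / v ≤ max (s / a) (s / b) := by
    intro s v hv1 hv2
    rcases le_total 0 s with hs | hs
    · exact le_max_of_le_left (by gcongr)
    · refine le_max_of_le_right ?_
      rw [div_le_div_iff₀ (ha.trans_le hv1) hb]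
      nlinarith
  have hdiv' : ∀ s v : ℝ, a ≤ v → v ≤ b → min (s / a) (s / b) ≤ s / v := by
    intro s v hv1 hv2
    have := hdiv (-s) v hv1 hv2
    rw [neg_div, neg_div, neg_div, max_neg_neg] at this
    linarith
  obtain ⟨h1, h2⟩ := ciInf_ciSup_mem_Icc (f := φ) (g := fun q h => φ' q h / w q h) hC hL hU
    (by fun_prop) (by fun_prop)
    (fun q h => by
      have hw : 0 < w q h := ha.trans_le (hwa q h)
      refine (hdiv' _ _ (hwa q h) (hwb q h)).trans ?_
      have := (abs_le.1 (hδ q h)).1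
      gcongr; linarith)
    (fun q h => by
      have hw : 0 < w q h := ha.trans_le (hwa q h)
      refine le_trans ?_ (hdiv _ _ (hwa q h) (hwb q h))
      have := (abs_le.1 (hδ q h)).2
      gcongr; linarith)
  set A := ⨅ q, ⨆ h, φ q h
  set A' := ⨅ q, ⨆ h, φ' q h / w q h
  obtain ⟨q⟩ := ‹Nonempty ι›
  have hδ0 : 0 ≤ δ := (abs_nonneg _).trans (hδ q (Classical.arbitrary _))
  constructor
  · intro hA
    have hba : δ / b ≤ δ / a := by gcongr
    rw [hA] at h1 h2
    simp only [L, U, zero_sub, zero_add, neg_div, max_eq_left hba, min_neg_neg] at h1 h2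
    exact abs_le.2 ⟨h1, h2⟩
  · intro hA hδA
    rcases hA.lt_or_gt with hA | hA
    · rw [abs_of_neg hA] at hδA ⊢
      have : A' ≤ A / (2 * b) := by
        refine h2.trans (max_le ?_ ?_)
        · rw [div_le_div_iff₀ ha (by positivity)]; nlinarith
        · rw [div_le_div_iff₀ hb (by positivity)]; nlinarith
      rw [neg_div]
      exact (neg_le_neg this).trans (neg_le_abs _)
    · rw [abs_of_pos hA] at hδA ⊢
      refine le_trans (le_trans (le_min ?_ ?_) h1) (le_abs_self _)
      · rw [div_le_div_iff₀ (by positivity) ha]; nlinarith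
      · rw [div_le_div_iff₀ (by positivity) hb]; nlinarith

end Order

/-! ### Deterministic estimates on a good sample path -/

section Paths

variable {𝓩 : Type*}

lemma rectInd_mul_instInd (B C : Set ℝ) (ζ : 𝓩) :
    rectInd B C * instInd ζ =
      {w : Obs 𝓩 | w.1 ∈ B ∧ w.2.1 ∈ C ∧ w.2.2 = ζ}.indicator (1 : Obs 𝓩 → ℝ) := by
  classical
  ext w
  unfold rectInd instInd
  rw [Pi.mul_apply, indicator_apply, indicator_apply, indicator_apply]
  simp only [mem_prod, mem_univ, mem_singleton_iff, true_and, and_true, mem_ofPred_eq,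
    Pi.one_apply]
  by_cases h1 : w.1 ∈ B <;> by_cases h2 : w.2.1 ∈ C <;> by_cases h3 : w.2.2 = ζ <;> simp [h1, h2, h3]

lemma instInd_eq_indicator (ζ : 𝓩) :
    instInd ζ = {w : Obs 𝓩 | w.2.2 = ζ}.indicator (1 : Obs 𝓩 → ℝ) := by
  unfold instInd
  congr 1
  ext w
  simp

lemma empMean_smul (x : ℕ → Obs 𝓩) (n : ℕ) (s : ℝ) (v : Obs 𝓩 → ℝ) :
    empMean x n (s • v) = s * empMean x n v := by
  simp only [empMean, Pi.smul_apply, smul_eq_mul, ← Finset.mul_sum]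
  ring

lemma empMean_mono (x : ℕ → Obs 𝓩) (n : ℕ) {v v' : Obs 𝓩 → ℝ} (h : ∀ w, v w ≤ v' w) :
    empMean x n v ≤ empMean x n v' :=
  mul_le_mul_of_nonneg_left (Finset.sum_le_sum fun _ _ => h _) (by positivity)

/-- The common shape of all test functions: up to sign, the indicator of an interval of outcomes
at one treatment level in `𝒟`, or of a lower half-line of treatments. -/
def IsTest (𝒟 : Set ℝ) (h : Obs 𝓩 → ℝ) : Prop :=
  ∃ s : ℝ, |s| = 1 ∧ ((∃ B : Set ℝ, B.OrdConnected ∧ B.Nonempty ∧ ∃ d ∈ 𝒟, h = s • rectInd B {d}) ∨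
    ∃ c : ℝ, h = s • rectInd univ (Iic c))

lemma IsTest.sq_le_one {𝒟 : Set ℝ} {h : Obs 𝓩 → ℝ} (hh : IsTest 𝒟 h) (w : Obs 𝓩) :
    h w ^ 2 ≤ 1 := by
  have key : ∀ (s : ℝ) (B C : Set ℝ), |s| = 1 → (s • rectInd B C : Obs 𝓩 → ℝ) w ^ 2 ≤ 1 := by
    classical
    intro s B C hs
    have hs2 : s ^ 2 = 1 := by rw [← sq_abs, hs, one_pow]
    simp only [Pi.smul_apply, smul_eq_mul, mul_pow, hs2, one_mul, rectInd]
    rw [indicator_apply]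
    split_ifs <;> simp
  obtain ⟨s, hs, ⟨B, -, -, d, -, rfl⟩ | ⟨c, rfl⟩⟩ := hh
  · exact key _ _ _ hs
  · exact key _ _ _ hs

/-- The chains of events that control all test functions with levels in `𝒟`. -/
def testChain {K : ℕ} (z : Fin K → 𝓩) (𝒟 : Finset ℝ) : Fin K × Option 𝒟 → ℚ → Set (Obs 𝓩)
  | (k, some d), q => Prod.fst ⁻¹' Iic (q : ℝ) ∩ {w | w.2.1 = d ∧ w.2.2 = z k}
  | (k, none), q => (fun w => w.2.1) ⁻¹' Iic (q : ℝ) ∩ {w | w.2.2 = z k}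

lemma monotone_testChain {K : ℕ} (z : Fin K → 𝓩) (𝒟 : Finset ℝ) (c : Fin K × Option 𝒟) :
    Monotone (testChain z 𝒟 c) := by
  rintro q q' hq
  have hq' : (q : ℝ) ≤ q' := by exact_mod_cast hq
  obtain ⟨k, _ | d⟩ := c
  · exact inter_subset_inter_left _ (preimage_mono (Iic_subset_Iic.2 hq'))
  · exact inter_subset_inter_left _ (preimage_mono (Iic_subset_Iic.2 hq'))

variable [MeasurableSpace 𝓩]

lemma abs_empMean_sub_popMean_indicator (P : Measure (Obs 𝓩)) (x : ℕ → Obs 𝓩) (n : ℕ)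
    {S : Set (Obs 𝓩)} (hS : MeasurableSet S) :
    |empMean x n (S.indicator 1) - popMean P (S.indicator 1)| = empDev P x n S := by
  rw [popMean, integral_indicator_one hS]; rfl

lemma popMean_smul (P : Measure (Obs 𝓩)) (s : ℝ) (v : Obs 𝓩 → ℝ) :
    popMean P (s • v) = s * popMean P v :=
  integral_const_mul s v

variable [MeasurableSingletonClass 𝓩]

lemma measurableSet_inst (ζ : 𝓩) : MeasurableSet {w : Obs 𝓩 | w.2.2 = ζ} :=
  (measurable_snd.comp measurable_snd) (measurableSet_singleton ζ)

lemma measurableSet_level_inst (d : ℝ) (ζ : 𝓩) :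
    MeasurableSet {w : Obs 𝓩 | w.2.1 = d ∧ w.2.2 = ζ} :=
  ((measurable_fst.comp measurable_snd) (measurableSet_singleton d)).inter (measurableSet_inst ζ)

lemma measurableSet_testChain {K : ℕ} (z : Fin K → 𝓩) (𝒟 : Finset ℝ) (c : Fin K × Option 𝒟)
    (q : ℚ) : MeasurableSet (testChain z 𝒟 c q) := by
  obtain ⟨k, _ | d⟩ := c
  · exact ((measurable_fst.comp measurable_snd) measurableSet_Iic).inter (measurableSet_inst _)
  · exact (measurable_fst measurableSet_Iic).inter (measurableSet_level_inst _ _)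

variable {P : Measure (Obs 𝓩)} [IsProbabilityMeasure P] {K : ℕ} {z : Fin K → 𝓩} {𝒟 : Finset ℝ}
  {x : ℕ → Obs 𝓩} {n : ℕ} {t : ℝ}

omit [IsProbabilityMeasure P] in
lemma popMean_instInd (ζ : 𝓩) : popMean P (instInd ζ) = P.real {w | w.2.2 = ζ} := by
  rw [instInd_eq_indicator, popMean, integral_indicator_one (measurableSet_inst ζ)]

lemma abs_empMean_sub_popMean_instInd_le
    (h : ∀ c q, empDev P x n (testChain z 𝒟 c q) ≤ t) (k : Fin K) :
    |empMean x n (instInd (z k)) - popMean P (instInd (z k))| ≤ t := by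
  rw [instInd_eq_indicator, abs_empMean_sub_popMean_indicator _ _ _ (measurableSet_inst _)]
  exact empDev_univ_le (measurable_fst.comp measurable_snd) (measurableSet_inst _)
    fun q => h (k, none) q

/-- Reduces every numerator of `φ`, up to sign, to the frequency of one event controlled by the
chains. -/
lemma IsTest.exists_mul_instInd {h : Obs 𝓩 → ℝ} (hh : IsTest (𝒟 : Set ℝ) h) (k : Fin K) :
    ∃ s : ℝ, |s| = 1 ∧ ∃ R : Set (Obs 𝓩), MeasurableSet R ∧ R ⊆ {w | w.2.2 = z k} ∧
      h * instInd (z k) = s • R.indicator 1 ∧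
      ∀ (x : ℕ → Obs 𝓩) (n : ℕ) (t : ℝ), (∀ c q, empDev P x n (testChain z 𝒟 c q) ≤ t) →
        empDev P x n R ≤ 2 * t := by
  obtain ⟨s, hs, ⟨B, hB, hBne, d, hd, rfl⟩ | ⟨c, rfl⟩⟩ := hh
  · refine ⟨s, hs, {w | w.1 ∈ B ∧ w.2.1 ∈ ({d} : Set ℝ) ∧ w.2.2 = z k}, ?_, fun w hw => hw.2.2, ?_,
      fun x n t h => ?_⟩
    · exact (measurable_fst hB.measurableSet).inter (measurableSet_level_inst d (z k))
    · rw [smul_mul_assoc, rectInd_mul_instInd]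
    · exact empDev_ordConnected_le measurable_fst (measurableSet_level_inst d (z k))
        (fun q => h (k, some ⟨d, hd⟩) q) hB hBne
  · refine ⟨s, hs, {w | w.1 ∈ (univ : Set ℝ) ∧ w.2.1 ∈ Iic c ∧ w.2.2 = z k}, ?_,
      fun w hw => hw.2.2, ?_, fun x n t h => ?_⟩
    · exact (measurable_fst MeasurableSet.univ).inter
        (((measurable_fst.comp measurable_snd) measurableSet_Iic).inter (measurableSet_inst (z k)))
    · rw [smul_mul_assoc, rectInd_mul_instInd]
    · have := empDev_ordConnected_le (W := fun w : Obs 𝓩 => w.2.1)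
        (measurable_fst.comp measurable_snd) (measurableSet_inst (z k))
        (fun q => h (k, none) q) (ordConnected_Iic (a := c)) nonempty_Iic
      convert this using 2
      ext w
      simp

lemma IsTest.abs_empMean_sub_popMean_le {h : Obs 𝓩 → ℝ} (hh : IsTest (𝒟 : Set ℝ) h)
    (hgood : ∀ c q, empDev P x n (testChain z 𝒟 c q) ≤ t) (k : Fin K) :
    |empMean x n (h * instInd (z k)) - popMean P (h * instInd (z k))| ≤ 2 * t := by
  obtain ⟨s, hs, R, hR, -, heq, hdev⟩ := hh.exists_mul_instInd (P := P) (z := z) k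
  rw [heq, empMean_smul, popMean_smul, ← mul_sub, abs_mul, hs, one_mul,
    abs_empMean_sub_popMean_indicator _ _ _ hR]
  exact hdev x n t hgood

lemma IsTest.abs_popMean_le {h : Obs 𝓩 → ℝ} (hh : IsTest (𝒟 : Set ℝ) h) (k : Fin K) :
    |popMean P (h * instInd (z k))| ≤ popMean P (instInd (z k)) := by
  obtain ⟨s, hs, R, hR, hRk, heq, -⟩ := hh.exists_mul_instInd (P := P) (z := z) k
  rw [heq, popMean_smul, abs_mul, hs, one_mul, popMean, integral_indicator_one hR,
    abs_of_nonneg measureReal_nonneg, popMean_instInd]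
  exact measureReal_mono hRk

/-- Over a common denominator the numerator is at most `3 t b`, thanks to `|a| ≤ b`. The factor `b`
cancels and `b' ≥ p / 2` gives the constant `6`. -/
lemma abs_div_sub_div_le {a b a' b' p t : ℝ} (hp : 0 < p) (hb : p ≤ b) (hab : |a| ≤ b)
    (ha' : |a' - a| ≤ 2 * t) (hb' : |b' - b| ≤ t) (ht : t ≤ p / 2) :
    |a' / b' - a / b| ≤ 6 * t / p := by
  have h1 := (abs_le.1 hb').1
  have hb'p : p / 2 ≤ b' := by linarith
  have hb0 : 0 < b := by linarith
  have hb'0 : 0 < b' := by linarith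
  have ht0 : 0 ≤ t := (abs_nonneg _).trans hb'
  have heq : a' / b' - a / b = ((a' - a) * b - a * (b' - b)) / (b' * b) := by
    field_simp; ring
  rw [heq, abs_div, abs_of_pos (mul_pos hb'0 hb0), div_le_div_iff₀ (by positivity) hp]
  have h2 : |(a' - a) * b - a * (b' - b)| ≤ 3 * t * b := by
    refine (abs_sub _ _).trans ?_
    rw [abs_mul, abs_mul, abs_of_pos hb0]
    have := mul_le_mul_of_nonneg_right ha' hb0.le
    have := mul_le_mul hab hb' (abs_nonneg _) hb0.le
    linarith
  calc _ ≤ 3 * t * b * (2 * b') := by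
        refine mul_le_mul h2 (by linarith) hp.le (by positivity)
    _ = _ := by ring

/-- Boundedness makes the real-valued suprema genuine rather than the default value `0`. -/
lemma abs_phi_popMean_le {p : ℝ} (hp : 0 < p) (hpk : ∀ k, p ≤ popMean P (instInd (z k)))
    {h : Obs 𝓩 → ℝ} (hh : IsTest (𝒟 : Set ℝ) h) (k k' : Fin K) :
    |phi (popMean P) h (instInd (z k), instInd (z k'))| ≤ 2 := by
  have key : ∀ k, |popMean P (h * instInd (z k)) / popMean P (instInd (z k))| ≤ 1 := fun k => by
    have : 0 < popMean P (instInd (z k)) := hp.trans_le (hpk k)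
    rw [abs_div, abs_of_pos this, div_le_one this]
    exact hh.abs_popMean_le k
  refine (abs_sub _ _).trans ?_
  have := key k
  have := key k'
  dsimp only
  linarith

lemma abs_phi_empMean_sub_le {p : ℝ} (hp : 0 < p) (hpk : ∀ k, p ≤ popMean P (instInd (z k)))
    (ht : t ≤ p / 2) (hgood : ∀ c q, empDev P x n (testChain z 𝒟 c q) ≤ t)
    {h : Obs 𝓩 → ℝ} (hh : IsTest (𝒟 : Set ℝ) h) (k k' : Fin K) :
    |phi (empMean x n) h (instInd (z k), instInd (z k')) -
      phi (popMean P) h (instInd (z k), instInd (z k'))| ≤ 12 * t / p := by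
  have key : ∀ k, |empMean x n (h * instInd (z k)) / empMean x n (instInd (z k)) -
      popMean P (h * instInd (z k)) / popMean P (instInd (z k))| ≤ 6 * t / p := fun k =>
    abs_div_sub_div_le hp (hpk k) (hh.abs_popMean_le k) (hh.abs_empMean_sub_popMean_le hgood k)
      (abs_empMean_sub_popMean_instInd_le hgood k) ht
  unfold phi
  dsimp only
  rw [sub_sub_sub_comm]
  refine (abs_sub _ _).trans ?_
  have h1 := key k
  have h2 := key k'
  calc _ ≤ 6 * t / p + 6 * t / p := by linarith
    _ = _ := by ring

lemma empMean_instInd_mem_Icc (hn : n ≠ 0) {p : ℝ}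
    (hpk : ∀ k, p ≤ popMean P (instInd (z k)))
    (ht : t ≤ p / 2) (hgood : ∀ c q, empDev P x n (testChain z 𝒟 c q) ≤ t) (k : Fin K) :
    empMean x n (instInd (z k)) ∈ Icc (p / 2) 1 := by
  have h1 := (abs_le.1 (abs_empMean_sub_popMean_instInd_le hgood k)).1
  have h2 := hpk k
  refine ⟨by linarith, (empMean_mono x n (v' := fun _ => 1) fun w => ?_).trans ?_⟩
  · classical
    rw [instInd_eq_indicator, indicator_apply]
    split_ifs <;> simp
  · have : (n : ℝ) ≠ 0 := by exact_mod_cast hn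
    simp [empMean, this]

lemma effSize_div_mem_Icc (hn : n ≠ 0) {p : ℝ} (hp : 0 < p)
    (hpk : ∀ k, p ≤ popMean P (instInd (z k)))
    (ht : t ≤ p / 2) (hgood : ∀ c q, empDev P x n (testChain z 𝒟 c q) ≤ t) :
    effSize z x n / n ∈ Icc ((p / 2) ^ K) 1 := by
  have hn' : (n : ℝ) ≠ 0 := by exact_mod_cast hn
  have h := empMean_instInd_mem_Icc hn hpk ht hgood
  rw [effSize, mul_div_cancel_left₀ _ hn']
  constructor
  · calc (p / 2) ^ K = ∏ _k : Fin K, p / 2 := by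
          rw [Finset.prod_const, Finset.card_univ, Fintype.card_fin]
      _ ≤ _ := Finset.prod_le_prod (fun _ _ => by positivity) fun k _ => (h k).1
  · exact Finset.prod_le_one (fun k _ => (by positivity : 0 ≤ p / 2).trans (h k).1)
      fun k _ => (h k).2

/-- The subtracted terms are nonnegative and can be dropped. Since `h² ≤ 1`, each remaining ratio is
at most the inverse frequency of an instrument value, hence at most `2 / p`, and the prefactor is at
most `1`. -/
lemma varHat_le (hn : n ≠ 0) {p : ℝ} (hp : 0 < p)
    (hpk : ∀ k, p ≤ popMean P (instInd (z k)))
    (ht : t ≤ p / 2) (hgood : ∀ c q, empDev P x n (testChain z 𝒟 c q) ≤ t)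
    {h : Obs 𝓩 → ℝ} (hh : IsTest (𝒟 : Set ℝ) h) (k k' : Fin K) :
    varHat z x n h (instInd (z k), instInd (z k')) ≤ 4 / p := by
  have hT := effSize_div_mem_Icc hn hp hpk ht hgood
  have hT0 : 0 ≤ effSize z x n / n := (by positivity : 0 ≤ (p / 2) ^ K).trans hT.1
  have key : ∀ k, empMean x n (h ^ 2 * instInd (z k)) / empMean x n (instInd (z k)) ^ 2
      - empMean x n (h * instInd (z k)) ^ 2 / empMean x n (instInd (z k)) ^ 3 ≤ 2 / p := fun k => by
    have he := (empMean_instInd_mem_Icc hn hpk ht hgood k).1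
    have he0 : 0 < empMean x n (instInd (z k)) := by linarith
    have h1 : 0 ≤ empMean x n (h * instInd (z k)) ^ 2 / empMean x n (instInd (z k)) ^ 3 := by
      positivity
    have h2 : empMean x n (h ^ 2 * instInd (z k)) ≤ empMean x n (instInd (z k)) :=
      empMean_mono x n fun w => by
        have hi : 0 ≤ instInd (z k) w := by
          rw [instInd_eq_indicator]; exact indicator_nonneg (fun _ _ => zero_le_one) _
        exact mul_le_of_le_one_left hi (hh.sq_le_one w)
    have h3 : empMean x n (h ^ 2 * instInd (z k)) / empMean x n (instInd (z k)) ^ 2 ≤ 2 / p := by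
      rw [div_le_div_iff₀ (by positivity) hp]
      have h4 := mul_le_mul_of_nonneg_right h2 hp.le
      have h5 := mul_le_mul_of_nonneg_left he he0.le
      nlinarith
    linarith
  have h1 := key k
  have h2 := key k'
  have hp4 : 0 ≤ 4 / p := by positivity
  unfold varHat
  refine (mul_le_mul_of_nonneg_left (b := _) (c := 4 / p) ?_ hT0).trans
    (mul_le_of_le_one_left hp4 hT.2)
  have : 4 / p = 2 / p + 2 / p := by ring
  dsimp only
  linarith

/-- On a sample path with small deviations along all chains the estimated contact set is exact. -/
lemma minContactSetHat_eq {ι : Type*} [Fintype ι] [Nonempty ι] {H : ι → Set (Obs 𝓩 → ℝ)}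
    (hne : ∀ q, (H q).Nonempty) (hH : ∀ q, ∀ h ∈ H q, IsTest (𝒟 : Set ℝ) h)
    {S : Set (𝓩 × 𝓩)} (hS : S ⊆ range z ×ˢ range z)
    (hn : n ≠ 0) {p ξ₀ τ : ℝ} (hp : 0 < p) (hξ₀ : 0 < ξ₀)
    (hpk : ∀ k, p ≤ popMean P (instInd (z k)))
    (ht : t ≤ p / 2) (hgood : ∀ c q, empDev P x n (testChain z 𝒟 c q) ≤ t)
    (hsmall : √n * (12 * t / p / ξ₀) ≤ τ)
    (hbig : ∀ g ∈ indicatorPairs S, (⨅ q, ⨆ h : H q, phi (popMean P) h.1 g) ≠ 0 →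
      12 * t / p ≤ |⨅ q, ⨆ h : H q, phi (popMean P) h.1 g| / 2 ∧
      τ < √n * √((p / 2) ^ K) *
        (|⨅ q, ⨆ h : H q, phi (popMean P) h.1 g| / (2 * max ξ₀ √(4 / p)))) :
    minContactSetHat z ξ₀ τ x n H (indicatorPairs S) = minContactSet P H (indicatorPairs S) := by
  have hne' : ∀ q, Nonempty (H q) := fun q => (hne q).to_subtype
  ext g
  refine and_congr_right fun hg => ?_
  have hg' := hg
  obtain ⟨⟨_, _⟩, hζ, rfl⟩ := hg'
  obtain ⟨⟨k, rfl⟩, ⟨k', rfl⟩⟩ := hS hζ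
  obtain ⟨hzero, hnz⟩ := abs_ciInf_ciSup_div (H := fun q => H q)
    (φ := fun q h => phi (popMean P) h.1 (instInd (z k), instInd (z k')))
    (φ' := fun q h => phi (empMean x n) h.1 (instInd (z k), instInd (z k')))
    (w := fun q h => max ξ₀ (√(varHat z x n h.1 (instInd (z k), instInd (z k')))))
    (fun q h => abs_phi_popMean_le hp hpk (hH q _ h.2) k k')
    (fun q h => abs_phi_empMean_sub_le hp hpk ht hgood (hH q _ h.2) k k')
    hξ₀ (le_max_left ξ₀ (√(4 / p))) (fun q h => le_max_left _ _)
    (fun q h => max_le_max le_rfl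
      (Real.sqrt_le_sqrt (varHat_le hn hp hpk ht hgood (hH q _ h.2) k k')))
  have hn' : (0 : ℝ) < n := by exact_mod_cast Nat.pos_of_ne_zero hn
  have hT := effSize_div_mem_Icc hn hp hpk ht hgood
  have hT1 : √(effSize z x n) ≤ √n := Real.sqrt_le_sqrt (by
    have := hT.2
    rwa [div_le_one hn'] at this)
  have hT2 : √n * √((p / 2) ^ K) ≤ √(effSize z x n) := by
    rw [← Real.sqrt_mul hn'.le]
    refine Real.sqrt_le_sqrt ?_
    have := hT.1
    rw [le_div_iff₀ hn'] at this
    linarith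
  constructor
  · intro hle
    by_contra hA
    obtain ⟨hb1, hb2⟩ := hbig _ hg hA
    exact absurd (hb2.trans_le (mul_le_mul hT2 (hnz hA hb1) (by positivity) (by positivity)))
      (not_lt.2 hle)
  · intro hA
    exact (mul_le_mul hT1 (hzero hA) (abs_nonneg _) (by positivity)).trans hsmall

end Paths

/-! ### Probability of exact recovery -/

section Consistency

variable {Ω : Type*} [MeasurableSpace Ω] {μ : Measure Ω} [IsProbabilityMeasure μ]

/-- Only subadditivity is used, so the recovery events `G n` need not be measurable. -/
lemma tendsto_measure_one_of_compl_le {B G : ℕ → Set Ω} {u : ℕ → ENNReal}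
    (hsub : ∀ᶠ n in atTop, (B n)ᶜ ⊆ G n) (hle : ∀ᶠ n in atTop, μ (B n) ≤ u n)
    (hu : Tendsto u atTop (𝓝 0)) : Tendsto (fun n => μ (G n)) atTop (𝓝 1) := by
  have h1 : Tendsto (fun n => 1 - u n) atTop (𝓝 1) := by
    simpa using ENNReal.Tendsto.sub (tendsto_const_nhds (x := (1 : ENNReal))) hu (by simp)
  refine tendsto_of_tendsto_of_tendsto_of_le_of_le' h1 tendsto_const_nhds ?_
    (.of_forall fun n => prob_le_one)
  filter_upwards [hsub, hle] with n hn hn'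
  rw [tsub_le_iff_right]
  calc (1 : ENNReal) = μ univ := measure_univ.symm
    _ ≤ μ (G n ∪ B n) := measure_mono fun ω _ => by
        by_cases h : ω ∈ B n
        · exact Or.inr h
        · exact Or.inl (hn h)
    _ ≤ μ (G n) + μ (B n) := measure_union_le _ _
    _ ≤ μ (G n) + u n := by gcongr

lemma tendsto_measure_valuePairs_eq {𝓩 : Type*} {S : Set (𝓩 × 𝓩)}
    {Ghat : ℕ → Ω → Set ((Obs 𝓩 → ℝ) × (Obs 𝓩 → ℝ))} {G : Set ((Obs 𝓩 → ℝ) × (Obs 𝓩 → ℝ))}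
    (h : Tendsto (fun n => μ {ω | Ghat n ω = G}) atTop (𝓝 1)) :
    Tendsto (fun n => μ {ω | valuePairs S (Ghat n ω) = valuePairs S G}) atTop (𝓝 1) :=
  tendsto_of_tendsto_of_tendsto_of_le_of_le h tendsto_const_nhds
    (fun n => measure_mono fun ω (hω : Ghat n ω = G) => show _ = _ by rw [hω])
    (fun n => prob_le_one)

lemma contactSet_eq_minContactSet {𝓩 : Type*} [MeasurableSpace 𝓩] (P : Measure (Obs 𝓩))
    (H : Set (Obs 𝓩 → ℝ)) (𝒢 : Set ((Obs 𝓩 → ℝ) × (Obs 𝓩 → ℝ))) :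
    contactSet P H 𝒢 = minContactSet P (fun _ : Unit => H) 𝒢 := by
  simp [contactSet, minContactSet]

lemma contactSetHat_eq_minContactSetHat {𝓩 : Type*} {K : ℕ} (z : Fin K → 𝓩) (ξ₀ t : ℝ)
    (x : ℕ → Obs 𝓩) (n : ℕ) (H : Set (Obs 𝓩 → ℝ)) (𝒢 : Set ((Obs 𝓩 → ℝ) × (Obs 𝓩 → ℝ))) :
    contactSetHat z ξ₀ t x n H 𝒢 = minContactSetHat z ξ₀ t x n (fun _ : Unit => H) 𝒢 := by
  simp [contactSetHat, minContactSetHat]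

variable {𝓩 : Type*} [MeasurableSpace 𝓩] [MeasurableSingletonClass 𝓩]
  {K : ℕ} {z : Fin K → 𝓩} {P : Measure (Obs 𝓩)} {X : ℕ → Ω → Obs 𝓩}

lemma exists_pos_le_popMean_instInd [IsFiniteMeasure P] (hpos : ∀ k, 0 < P {w | w.2.2 = z k}) :
    ∃ p > 0, ∀ k, p ≤ popMean P (instInd (z k)) := by
  have h : ∀ k, 0 < popMean P (instInd (z k)) := fun k => by
    rw [popMean_instInd]
    exact ENNReal.toReal_pos (hpos k).ne' (measure_ne_top _ _)
  rcases isEmpty_or_nonempty (Fin K) with hK | hK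
  · exact ⟨1, one_pos, fun k => (hK.false k).elim⟩
  · obtain ⟨k, hk⟩ := Finite.exists_min fun k => popMean P (instInd (z k))
    exact ⟨_, h k, hk⟩

theorem tendsto_measure_minContactSetHat_eq (hind : iIndepFun X μ) (hlaw : ∀ i, HasLaw (X i) P μ)
    (hpos : ∀ k, 0 < P {w | w.2.2 = z k}) {ξ₀ : ℝ} (hξ₀ : 0 < ξ₀) {τ : ℕ → ℝ}
    (hτ : Tendsto τ atTop atTop) (hτn : Tendsto (fun n : ℕ => τ n / √(n : ℝ)) atTop (𝓝 0))
    {ι : Type*} [Fintype ι] [Nonempty ι] {H : ι → Set (Obs 𝓩 → ℝ)} {𝒟 : Finset ℝ}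
    (hne : ∀ q, (H q).Nonempty) (hH : ∀ q, ∀ h ∈ H q, IsTest (𝒟 : Set ℝ) h)
    {S : Set (𝓩 × 𝓩)} (hS : S ⊆ range z ×ˢ range z) :
    Tendsto (fun n => μ {ω | minContactSetHat z ξ₀ (τ n) (fun i => X i ω) n H (indicatorPairs S) =
      minContactSet P H (indicatorPairs S)}) atTop (𝓝 1) := by
  have hP : IsProbabilityMeasure P := (hlaw 0).isProbabilityMeasure_iff.1 ‹_›
  obtain ⟨p, hp, hpk⟩ := exists_pos_le_popMean_instInd hpos
  set M := max ξ₀ √(4 / p)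
  have hM : 0 < M := hξ₀.trans_le (le_max_left _ _)
  -- Chosen so that `√n * (12 * t n / p / ξ₀)` equals `τ n` exactly.
  set c := ξ₀ * p / 12 with hc
  have hc0 : 0 < c := by positivity
  let t : ℕ → ℝ := fun n => c * (τ n / √n)
  have ht : Tendsto t atTop (𝓝 0) := by simpa using hτn.const_mul c
  have hSfin : (indicatorPairs S).Finite :=
    (((finite_range z).prod (finite_range z)).subset hS).image _
  have hbig : ∀ᶠ n in atTop, ∀ g ∈ indicatorPairs S,
      (⨅ q, ⨆ h : H q, phi (popMean P) h.1 g) ≠ 0 →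
      12 * t n / p ≤ |⨅ q, ⨆ h : H q, phi (popMean P) h.1 g| / 2 ∧
      τ n < √n * √((p / 2) ^ K) * (|⨅ q, ⨆ h : H q, phi (popMean P) h.1 g| / (2 * M)) := by
    refine (hSfin.eventually_all (l := atTop)).2 fun g _ => ?_
    by_cases hA : (⨅ q, ⨆ h : H q, phi (popMean P) h.1 g) = 0
    · exact .of_forall fun n h => (h hA).elim
    have hA' := abs_pos.2 hA
    have h1 : Tendsto (fun n => 12 * t n / p) atTop (𝓝 0) := by
      simpa using (ht.const_mul 12).div_const p
    filter_upwards [h1.eventually (gt_mem_nhds (half_pos hA')),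
      hτn.eventually (gt_mem_nhds (show 0 < √((p / 2) ^ K) *
        (|⨅ q, ⨆ h : H q, phi (popMean P) h.1 g| / (2 * M)) by positivity)),
      eventually_gt_atTop 0] with n hn1 hn2 hn3 _
    have hn : (0 : ℝ) < √n := Real.sqrt_pos.2 (by exact_mod_cast hn3)
    refine ⟨hn1.le, ?_⟩
    rw [div_lt_iff₀ hn] at hn2
    linarith
  have hcard : Tendsto (fun n : ℕ => (Fintype.card (Fin K × Option 𝒟) : ENNReal) *
      ENNReal.ofReal (16 / (n * t n ^ 2))) atTop (𝓝 0) := by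
    have h1 : Tendsto (fun n : ℕ => 16 / (n * t n ^ 2)) atTop (𝓝 0) := by
      -- Here `n * t n ^ 2 = c ^ 2 * τ n ^ 2`: divergence of `τ` is what makes the bad event
      -- negligible.
      have h2 : Tendsto (fun n => 16 / (c ^ 2 * τ n ^ 2)) atTop (𝓝 0) :=
        tendsto_const_nhds.div_atTop
          (((tendsto_pow_atTop two_ne_zero).comp hτ).const_mul_atTop (by positivity))
      refine h2.congr' ?_
      filter_upwards [eventually_gt_atTop 0] with n hn
      have hn' : (0 : ℝ) < n := by exact_mod_cast hn
      congr 1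
      simp only [t]
      rw [mul_pow c, div_pow (τ n), Real.sq_sqrt hn'.le]
      field_simp
    have h3 := ENNReal.tendsto_ofReal h1
    rw [ENNReal.ofReal_zero] at h3
    have h4 := ENNReal.Tendsto.const_mul h3
      (Or.inr (ENNReal.natCast_ne_top (Fintype.card (Fin K × Option 𝒟))))
    rwa [mul_zero] at h4
  refine tendsto_measure_one_of_compl_le
    (B := fun n => {ω | ∃ c q, t n < empDev P (fun i => X i ω) n (testChain z 𝒟 c q)}) ?_ ?_ hcard
  · filter_upwards [hbig, ht.eventually (gt_mem_nhds (half_pos hp)), eventually_gt_atTop 0]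
      with n hb hn1 hn2 ω hω
    have hgood : ∀ c q, empDev P (fun i => X i ω) n (testChain z 𝒟 c q) ≤ t n := fun c q =>
      not_lt.1 fun h => hω ⟨c, q, h⟩
    have hn : (0 : ℝ) < √n := Real.sqrt_pos.2 (by exact_mod_cast hn2)
    refine minContactSetHat_eq hne hH hS hn2.ne' hp hξ₀ hpk hn1.le hgood (le_of_eq ?_) hb
    simp only [t, hc]
    field_simp
  · filter_upwards [hτ.eventually (eventually_gt_atTop 0), eventually_gt_atTop 0] with n hn1 hn2
    have hn : (0 : ℝ) < √n := Real.sqrt_pos.2 (by exact_mod_cast hn2)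
    exact measure_exists_exists_lt_empDev_le hind hlaw (measurableSet_testChain z 𝒟)
      (monotone_testChain z 𝒟) hn2.ne' (by positivity)

theorem tendsto_measure_contactSetHat_eq (hind : iIndepFun X μ) (hlaw : ∀ i, HasLaw (X i) P μ)
    (hpos : ∀ k, 0 < P {w | w.2.2 = z k}) {ξ₀ : ℝ} (hξ₀ : 0 < ξ₀) {τ : ℕ → ℝ}
    (hτ : Tendsto τ atTop atTop) (hτn : Tendsto (fun n : ℕ => τ n / √(n : ℝ)) atTop (𝓝 0))
    {H : Set (Obs 𝓩 → ℝ)} {𝒟 : Finset ℝ}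
    (hne : H.Nonempty) (hH : ∀ h ∈ H, IsTest (𝒟 : Set ℝ) h)
    {S : Set (𝓩 × 𝓩)} (hS : S ⊆ range z ×ˢ range z) :
    Tendsto (fun n => μ {ω | contactSetHat z ξ₀ (τ n) (fun i => X i ω) n H (indicatorPairs S) =
      contactSet P H (indicatorPairs S)}) atTop (𝓝 1) := by
  simp_rw [contactSet_eq_minContactSet, contactSetHat_eq_minContactSetHat]
  exact tendsto_measure_minContactSetHat_eq hind hlaw hpos hξ₀ hτ hτn (fun _ => hne)
    (fun _ => hH) hS

end Consistency

/-! ### The three families of test functions -/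

section Classes

lemma abs_neg_one_pow_eq_one (m : ℕ) : |(-1 : ℝ) ^ m| = 1 := by simp

lemma isClosedInterval_univ : IsClosedInterval univ :=
  ⟨univ_nonempty, ordConnected_univ, isClosed_univ⟩

variable {𝓩 : Type*}

lemma isTest_of_mem_binaryTests {h : Obs 𝓩 → ℝ} (hh : h ∈ binaryTests 𝓩) :
    IsTest (({0, 1} : Finset ℝ) : Set ℝ) h := by
  obtain ⟨B, hB, d, rfl⟩ := hh
  refine ⟨_, abs_neg_one_pow_eq_one d, Or.inl ⟨B, hB.2.1, hB.1, _, ?_, rfl⟩⟩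
  fin_cases d <;> simp

lemma isTest_of_mem_orderedTests {lo hi : ℝ} {h : Obs 𝓩 → ℝ} (hh : h ∈ orderedTests 𝓩 lo hi) :
    IsTest (({lo, hi} : Finset ℝ) : Set ℝ) h := by
  obtain ⟨B, hB, rfl | rfl⟩ | ⟨c, rfl⟩ := hh
  · exact ⟨1, by simp, Or.inl ⟨B, hB.2.1, hB.1, lo, by simp, by simp⟩⟩
  · exact ⟨-1, by simp, Or.inl ⟨B, hB.2.1, hB.1, hi, by simp, by simp⟩⟩
  · exact ⟨1, by simp, Or.inr ⟨c, by simp⟩⟩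

lemma isTest_of_mem_unorderedTests {J : ℕ} {d : Fin J → ℝ} {v : Fin J → Fin 2} {h : Obs 𝓩 → ℝ}
    (hh : h ∈ unorderedTests 𝓩 d v) : IsTest ((Finset.univ.image d : Finset ℝ) : Set ℝ) h := by
  obtain ⟨B, hB, j, rfl⟩ := hh
  exact ⟨_, abs_neg_one_pow_eq_one _, Or.inl ⟨B, hB.2.1, hB.1, d j, by simp, rfl⟩⟩

lemma allPairs_subset {K : ℕ} (z : Fin K → 𝓩) : allPairs z ⊆ range z ×ˢ range z := by
  rintro _ ⟨k, k', -, rfl⟩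
  exact ⟨mem_range_self k, mem_range_self k'⟩

lemma increasingPairs_subset {K : ℕ} (z : Fin K → 𝓩) : increasingPairs z ⊆ range z ×ˢ range z := by
  rintro _ ⟨k, k', -, rfl⟩
  exact ⟨mem_range_self k, mem_range_self k'⟩

end Classes
end PairwiseIV

open PairwiseIV
theorem mainTheorem3
    {Ω : Type*} [MeasurableSpace Ω] (μ : Measure Ω) [IsProbabilityMeasure μ]
    {𝓩 : Type*} [MeasurableSpace 𝓩] [MeasurableSingletonClass 𝓩]
    {K : ℕ} (z : Fin K → 𝓩) (hz : Function.Injective z)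
    (P : Measure (Obs 𝓩))
    (Y : ℕ → Ω → ℝ) (D : ℕ → Ω → ℝ) (Z : ℕ → Ω → 𝓩)
    (hindep : iIndepFun (fun i ω => ((Y i ω, D i ω, Z i ω) : Obs 𝓩)) μ)
    (hlaw : ∀ i, HasLaw (fun ω => ((Y i ω, D i ω, Z i ω) : Obs 𝓩)) P μ)
    (hZ : ∀ᵐ w ∂P, w.2.2 ∈ Set.range z)
    (hpos : ∀ k, 0 < P {w | w.2.2 = z k})
    (ξ₀ : ℝ) (hξ₀ : 0 < ξ₀)
    (τ : ℕ → ℝ) (hτ : Tendsto τ atTop atTop)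
    (hτn : Tendsto (fun n : ℕ => τ n / √(n : ℝ)) atTop (𝓝 0)) :
    -- binary treatment
    ((∀ᵐ w ∂P, w.2.1 = 0 ∨ w.2.1 = 1) →
      let 𝒢P := indicatorPairs (allPairs z)
      let G₀ := contactSet P (binaryTests 𝓩) 𝒢P
      let Ghat₀ := fun (n : ℕ) (ω : Ω) =>
        contactSetHat z ξ₀ (τ n) (fun i => (Y i ω, D i ω, Z i ω)) n (binaryTests 𝓩) 𝒢P
      Tendsto (fun n => μ {ω | Ghat₀ n ω = G₀}) atTop (𝓝 1) ∧
      Tendsto (fun n => μ {ω | valuePairs (allPairs z) (Ghat₀ n ω) = valuePairs (allPairs z) G₀})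
        atTop (𝓝 1)) ∧
    -- ordered treatment
    (∀ (J : ℕ) (d : Fin (J + 1) → ℝ), StrictMono d → (∀ᵐ w ∂P, w.2.1 ∈ Set.range d) →
      let 𝒢P := indicatorPairs (allPairs z)
      let H := orderedTests 𝓩 (d 0) (d (Fin.last J))
      let G₁ := contactSet P H 𝒢P
      let Ghat₁ := fun (n : ℕ) (ω : Ω) =>
        contactSetHat z ξ₀ (τ n) (fun i => (Y i ω, D i ω, Z i ω)) n H 𝒢P
      Tendsto (fun n => μ {ω | Ghat₁ n ω = G₁}) atTop (𝓝 1) ∧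
      Tendsto (fun n => μ {ω | valuePairs (allPairs z) (Ghat₁ n ω) = valuePairs (allPairs z) G₁})
        atTop (𝓝 1)) ∧
    -- unordered treatment
    (∀ (J : ℕ) (d : Fin J → ℝ), Function.Injective d → (∀ᵐ w ∂P, w.2.1 ∈ Set.range d) →
      let 𝒢 := indicatorPairs (increasingPairs z)
      let G₁ := minContactSet P (unorderedTests 𝓩 d) 𝒢
      let Ghat₁ := fun (n : ℕ) (ω : Ω) =>
        minContactSetHat z ξ₀ (τ n) (fun i => (Y i ω, D i ω, Z i ω)) n (unorderedTests 𝓩 d) 𝒢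
      Tendsto (fun n => μ {ω | Ghat₁ n ω = G₁}) atTop (𝓝 1) ∧
      Tendsto (fun n => μ {ω | valuePairs (increasingPairs z) (Ghat₁ n ω) =
          valuePairs (increasingPairs z) G₁})
        atTop (𝓝 1)) := by
  refine ⟨fun _ => ?_, fun J d _ _ => ?_, fun J d _ hD => ?_⟩
  · have h := tendsto_measure_contactSetHat_eq hindep hlaw hpos hξ₀ hτ hτn (H := binaryTests 𝓩)
      ⟨_, univ, isClosedInterval_univ, 0, rfl⟩ (fun _ => isTest_of_mem_binaryTests)
      (allPairs_subset z)
    exact ⟨h, tendsto_measure_valuePairs_eq h⟩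
  · have h := tendsto_measure_contactSetHat_eq hindep hlaw hpos hξ₀ hτ hτn
      (H := orderedTests 𝓩 (d 0) (d (Fin.last J)))
      ⟨_, Or.inr ⟨0, rfl⟩⟩ (fun _ => isTest_of_mem_orderedTests)
      (allPairs_subset z)
    exact ⟨h, tendsto_measure_valuePairs_eq h⟩
  · have hP : IsProbabilityMeasure P := (hlaw 0).isProbabilityMeasure_iff.1 ‹_›
    -- A probability measure cannot be carried by an empty set of levels, so `J = 0` is excluded and
    -- every class is nonempty.
    obtain ⟨_, j, -⟩ := hD.exists
    have h := tendsto_measure_minContactSetHat_eq hindep hlaw hpos hξ₀ hτ hτn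
      (H := unorderedTests 𝓩 d)
      (fun v => ⟨_, univ, isClosedInterval_univ, j, rfl⟩)
      (fun _ _ => isTest_of_mem_unorderedTests) (increasingPairs_subset z)
    exact ⟨h, tendsto_measure_valuePairs_eq h⟩
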